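/- Let $M$ be a Hausdorff connected smooth $n$-manifold with base point $*$ and let $G$ be a Lie group with Lie algebra $\mathfrak g$. Let $PM$ be the set of piecewise smooth paths $[0,1]\to M$ starting at $*$ and $\Omega M\subset PM$ the set of loops at $*$. A composition $\alpha\circ\beta$ means first $\beta$, then $\alpha$; $\alpha^{-1}$ is the reversed path; $K(p,i)(t):=p(it)$. A family of paths $\tilde\psi:U\to PM$, with associated map $\psi(u,i)=\tilde\psi[u](i)$, is called smooth if $\psi$ is continuous on $U\times[0,1]$ and smooth on $U\times[i_k,i_{k+1}]$ for some partition $0=i_0<\dots<i_N=1$. A loop is thin if it can be contracted to the constant loop, by a homotopy of based loops, inside its own image. Let $H:\Omega M\to G$ be a holonomy map, i.e. (1) $H(\alpha\circ\beta)=H(\beta)H(\alpha)$; (2) $H(\alpha)=e$ for every thin loop $\alpha$; (3) $H\circ\tilde\Omega:U\to G$ is smooth for every smooth family of loops $\tilde\Omega:U\to\Omega M$, $U\subset\mathbb R^m$ open, $m\in\mathbb N$. Let $E:=(PM\times G)/T$, where $(p,g)\,T\,(p',g')$ iff $p(1)=p'(1)$ and $g'=H(p^{-1}\circ p')g$; write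 $\{p,g\}$ for the class of $(p,g)$, $\pi\{p,g\}:=p(1)$, $\{p,h\}g:=\{p,hg\}$. $E$ carries the smooth structure given by the local trivializations $C_\psi:U\times G\to\pi^{-1}(U)$, $C_\psi(u,g)=\{\tilde\psi[u],g\}$, where $U\subset M$ is open and $\tilde\psi:U\to PM$ is a smooth family with $\tilde\psi[u](1)=u$. For $a\in E$ let $V_a:=\ker(\pi_*:T_aE\to T_{\pi(a)}M)$ and let $\Gamma_a\subset T_aE$ be the span of all vectors $\frac{d}{di}\{K(r,i),h\}|_{i=j}$, where $r\in PM$ is smooth near $j\in(0,1)$ and $\{K(r,j),h\}=a$. Let $P_V$ be the projection of $T_aE$ onto $V_a$ along $\Gamma_a$, and define the connection 1-form $$\omega_a:T_aE\to\mathfrak g,\qquad \omega_aX_a:=(a^{-1})_*P_VX_a ,$$ where $a^{-1}:\pi^{-1}(\pi(a))\to G$ is the inverse of $g\mapsto ag$. Then the following hold. (0) $\omega$ is well defined: for every $a\in E$, $T_aE=V_a\oplus\Gamma_a$, and the differential at $e$ of $G\ni g\mapsto ag\in E$ is injective with image $V_a$. Moreover, for every $a\in E$, every $X_a\in T_aE$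 can be written as $X_a=\frac{d}{di}\{\tilde\chi[i],g(i)\}|_{i=j}$ with $\{\tilde\chi[j],g(j)\}=a$, where $0<j<1$ and $\tilde\chi:[0,1]\to PM$, $g:[0,1]\to G$ are smooth near $j$, and where the path $p(i):=\tilde\chi[i](1)$ is piecewise smooth with $p(0)=*$. (1) Let $0<j<1$, and let $\tilde\chi:[0,1]\to PM$ and $g:[0,1]\to G$ be smooth near $j$ (the former as a family of paths), such that $p(i):=\tilde\chi[i](1)$ is a piecewise smooth path in $M$. Put $a=\{\tilde\chi[j],g(j)\}$. Then $i\mapsto\{\tilde\chi[i],g(i)\}$ is differentiable at $j$, and with $X_a=\frac{d}{di}\{\tilde\chi[i],g(i)\}|_{i=j}$, $$\omega_aX_a=g(j)^{-1}\,\frac{d}{di}\,H\big(\tilde\chi[i]^{-1}\circ K(p,i)\circ K(p,j)^{-1}\circ\tilde\chi[j]\big)\,g(i)\Big|_{i=j},$$ where the function of $i$ that is differentiated is differentiable at $j$ with value $g(j)$ there, and $g(j)^{-1}$ acts by left translation $T_{g(j)}G\to\mathfrak g$. (2) Let $\tilde\psi:U\to PM$ be a smooth family as above, $\sigma(x):=C_\psi(x,e)$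 the corresponding local section, and let $y_1,\dots,y_n$ be smooth coordinates on an open subset of $U$ which identify it with a convex open subset of $\mathbb R^n$ (for example with $\mathbb R^n$), with coordinate vector fields $\partial_\mu$. For $x,y$ in this subset let $T_{y,x}(i)=x+i(y-x)$ be the straight segment from $x$ to $y$ in these coordinates. Then $\sigma$ is differentiable, the map $y\mapsto H(\tilde\psi[y]^{-1}\circ T_{y,x}\circ\tilde\psi[x])$ is differentiable at $y=x$ with value $e$ there, and the local coefficients of $\omega$ are $$A_\mu(x):=(\sigma^*\omega)_x\,\partial_\mu(x)=\frac{\partial}{\partial y_\mu}H\big(\tilde\psi[y]^{-1}\circ T_{y,x}\circ\tilde\psi[x]\big)\Big|_{y=x},\qquad \mu=1,\dots,n.$$ -/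

import Mathlib

open Set Filter Topology
open scoped Manifold ContDiff

namespace LoopHolonomy

abbrev Euc (n : ℕ) : Type := EuclideanSpace ℝ (Fin n)

section Paths

variable {M : Type*}

/-- The composition `α ∘ β` of two paths: first go along `β`, then along `α`. -/
noncomputable def pcomp (α β : unitInterval → M) : unitInterval → M := fun t =>
  if (t : ℝ) ≤ 1 / 2 then IccExtend zero_le_one β (2 * (t : ℝ))
  else IccExtend zero_le_one α (2 * (t : ℝ) - 1)

/-- The inverse of a path. -/
def pinv (α : unitInterval → M) : unitInterval → M := fun t => α (unitInterval.symm t)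

/-- The contraction `K(p,i)` of a path, `K(p,i)(j) = p(ij)`. -/
def contr (p : unitInterval → M) (i : unitInterval) : unitInterval → M := fun j => p (i * j)

end Paths

infixr:80 " ⊙ " => pcomp

section Families

variable (n : ℕ) {M : Type*} [TopologicalSpace M] [ChartedSpace (Euc n) M]

/-- Piecewise smoothness of a path: it is continuous, and there is a finite set `S` of break points
such that the path is smooth on every closed subinterval of `[0,1]` without break points in its
interior. -/
def PiecewiseSmooth (γ : unitInterval → M) : Prop :=
  Continuous γ ∧ ∃ S : Finset ℝ, ∀ a c : ℝ, 0 ≤ a → a ≤ c → c ≤ 1 → Disjoint (Ioo a c) (S : Set ℝ) →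
    ContMDiffOn 𝓘(ℝ, ℝ) (𝓡 n) ∞ (IccExtend zero_le_one γ) (Icc a c)

/-- Smoothness on the parameter set `U` of a family of paths `ψ : U → PM`: the associated map
`U × [0,1] → M` is continuous, and there is a finite set `S` of break points such that it is smooth
on `U × [a,c]` for every closed subinterval `[a,c]` of `[0,1]` without break points in its
interior. -/
def SmoothFamilyOn {F : Type*} [NormedAddCommGroup F] [NormedSpace ℝ F] {H' : Type*}
    [TopologicalSpace H'] (J : ModelWithCorners ℝ F H') {N : Type*} [TopologicalSpace N]
    [ChartedSpace H' N] (U : Set N) (ψ : N → unitInterval → M) : Prop :=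
  ContinuousOn (fun z : N × unitInterval => ψ z.1 z.2) (U ×ˢ univ) ∧
  ∃ S : Finset ℝ, ∀ a c : ℝ, 0 ≤ a → a ≤ c → c ≤ 1 → Disjoint (Ioo a c) (S : Set ℝ) →
    ContMDiffOn (J.prod 𝓘(ℝ, ℝ)) (𝓡 n) ∞
      (fun z : N × ℝ => IccExtend zero_le_one (ψ z.1) z.2) (U ×ˢ Icc a c)

variable {n}
variable {F : Type*} [NormedAddCommGroup F] [NormedSpace ℝ F] {H' : Type*}
    [TopologicalSpace H'] {J : ModelWithCorners ℝ F H'} {N : Type*} [TopologicalSpace N]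
    [ChartedSpace H' N]
    {F₂ : Type*} [NormedAddCommGroup F₂] [NormedSpace ℝ F₂] {H₂ : Type*}
    [TopologicalSpace H₂] {J₂ : ModelWithCorners ℝ F₂ H₂} {N₂ : Type*} [TopologicalSpace N₂]
    [ChartedSpace H₂ N₂]

theorem SmoothFamilyOn.const {γ : unitInterval → M} (h : PiecewiseSmooth n γ) (U : Set N) :
    SmoothFamilyOn n J U (fun _ => γ) := by
  obtain ⟨hc, S, hS⟩ := h
  refine ⟨(hc.comp continuous_snd).continuousOn, S, fun a c h0 hac h1 hd => ?_⟩
  exact (hS a c h0 hac h1 hd).comp contMDiff_snd.contMDiffOn (fun z hz => hz.2)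

theorem SmoothFamilyOn.comp {U : Set N} {ψ : N → unitInterval → M} (h : SmoothFamilyOn n J U ψ)
    {f : N₂ → N} {V : Set N₂} (hf : ContMDiffOn J₂ J ∞ f V) (hm : MapsTo f V U) :
    SmoothFamilyOn n J₂ V (fun v => ψ (f v)) := by
  obtain ⟨hc, S, hS⟩ := h
  refine ⟨?_, S, fun a c h0 hac h1 hd => ?_⟩
  · refine hc.comp (f := fun z : N₂ × unitInterval => (f z.1, z.2)) ?_ (fun z hz => ⟨hm hz.1, trivial⟩)
    exact (hf.continuousOn.comp continuousOn_fst (fun z hz => hz.1)).prodMk continuousOn_snd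
  · refine (hS a c h0 hac h1 hd).comp (f := fun z : N₂ × ℝ => (f z.1, z.2)) ?_
      (fun z hz => ⟨hm hz.1, hz.2⟩)
    exact (hf.comp contMDiff_fst.contMDiffOn (fun z hz => hz.1)).prodMk
      contMDiff_snd.contMDiffOn

theorem SmoothFamilyOn.mono {U V : Set N} {ψ : N → unitInterval → M} (h : SmoothFamilyOn n J U ψ)
    (hV : V ⊆ U) : SmoothFamilyOn n J V ψ := by
  obtain ⟨hc, S, hS⟩ := h
  exact ⟨hc.mono (prod_mono hV Subset.rfl), S, fun a c h0 hac h1 hd =>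
    (hS a c h0 hac h1 hd).mono (prod_mono hV Subset.rfl)⟩

theorem SmoothFamilyOn.congr {U : Set N} {ψ ψ' : N → unitInterval → M} (h : SmoothFamilyOn n J U ψ)
    (hψ : ∀ u ∈ U, ψ' u = ψ u) : SmoothFamilyOn n J U ψ' := by
  obtain ⟨hc, S, hS⟩ := h
  refine ⟨hc.congr (fun z hz => by simp [hψ z.1 hz.1]), S, fun a c h0 hac h1 hd =>
    (hS a c h0 hac h1 hd).congr (fun z hz => by simp [hψ z.1 hz.1])⟩

theorem SmoothFamilyOn.piecewiseSmooth {U : Set N} {ψ : N → unitInterval → M}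
    (h : SmoothFamilyOn n J U ψ) {u : N} (hu : u ∈ U) : PiecewiseSmooth n (ψ u) := by
  obtain ⟨hc, S, hS⟩ := h
  refine ⟨?_, S, fun a c h0 hac h1 hd => ?_⟩
  · rw [← continuousOn_univ]
    exact hc.comp (f := fun t : unitInterval => (u, t)) (by fun_prop) (fun t _ => ⟨hu, trivial⟩)
  · exact (hS a c h0 hac h1 hd).comp (f := fun t : ℝ => (u, t))
      (contMDiffOn_const.prodMk contMDiffOn_id) (fun t ht => ⟨hu, ht⟩)

theorem SmoothFamilyOn.pinv {U : Set N} {ψ : N → unitInterval → M} (h : SmoothFamilyOn n J U ψ) :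
    SmoothFamilyOn n J U (fun u => pinv (ψ u)) := by
  classical
  obtain ⟨hc, S, hS⟩ := h
  refine ⟨?_, S.image (fun s => 1 - s), fun a c h0 hac h1 hd => ?_⟩
  · exact hc.comp (f := fun z : N × unitInterval => (z.1, unitInterval.symm z.2)) (by fun_prop)
      (fun z hz => ⟨hz.1, trivial⟩)
  · have hd' : Disjoint (Ioo (1 - c) (1 - a)) (S : Set ℝ) := by
      rw [Set.disjoint_left] at hd ⊢
      intro x hx hxS
      exact hd (a := 1 - x) ⟨by linarith [hx.2], by linarith [hx.1]⟩
        (by simpa using hxS)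
    have key := hS (1 - c) (1 - a) (by linarith) (by linarith) (by linarith) hd'
    have hsub : ContMDiff (J.prod 𝓘(ℝ, ℝ)) 𝓘(ℝ, ℝ) ∞ (fun z : N × ℝ => 1 - z.2) :=
      ((contDiff_const.sub contDiff_id : ContDiff ℝ ∞ (fun t : ℝ => 1 - t)).contMDiff).comp
        contMDiff_snd
    refine (key.comp (f := fun z : N × ℝ => (z.1, 1 - z.2))
      (contMDiff_fst.prodMk hsub).contMDiffOn
      (fun z hz => ⟨hz.1, by linarith [hz.2.2], by linarith [hz.2.1]⟩)).congr ?_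
    intro z hz
    have hz2 : z.2 ∈ Icc (0 : ℝ) 1 := ⟨h0.trans hz.2.1, hz.2.2.trans h1⟩
    have hz3 : 1 - z.2 ∈ Icc (0 : ℝ) 1 := ⟨by linarith [hz2.2], by linarith [hz2.1]⟩
    simp only [Function.comp]
    rw [IccExtend_of_mem _ _ hz2, IccExtend_of_mem _ _ hz3]
    rfl

theorem SmoothFamilyOn.pcomp {U : Set N} {α β : N → unitInterval → M} (hα : SmoothFamilyOn n J U α)
    (hβ : SmoothFamilyOn n J U β) (h : ∀ u ∈ U, β u 1 = α u 0) :
    SmoothFamilyOn n J U (fun u => α u ⊙ β u) := by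
  classical
  obtain ⟨hcα, S, hS⟩ := hα
  obtain ⟨hcβ, T, hT⟩ := hβ
  refine ⟨?_, insert (1 / 2) (S.image (fun s => (s + 1) / 2) ∪ T.image (fun s => s / 2)),
    fun a c h0 hac h1 hd => ?_⟩
  · rw [continuousOn_iff_continuous_domRestrict]
    have hp : Continuous (fun z : ↥(U ×ˢ (univ : Set unitInterval)) => z.1.1) := by fun_prop
    refine Continuous.if_le (f := fun z : ↥(U ×ˢ (univ : Set unitInterval)) => (z.1.2 : ℝ))
      (g := fun _ => (1 / 2 : ℝ))
      (f' := fun z => IccExtend zero_le_one (β z.1.1) (2 * (z.1.2 : ℝ)))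
      (g' := fun z => IccExtend zero_le_one (α z.1.1) (2 * (z.1.2 : ℝ) - 1)) ?_ ?_
      (by fun_prop) (by fun_prop) ?_
    · exact hcβ.comp_continuous
        (f := fun z : ↥(U ×ˢ (univ : Set unitInterval)) =>
          (z.1.1, projIcc (0 : ℝ) 1 zero_le_one (2 * (z.1.2 : ℝ))))
        (hp.prodMk (continuous_projIcc.comp (by fun_prop))) (fun z => ⟨z.2.1, trivial⟩)
    · exact hcα.comp_continuous
        (f := fun z : ↥(U ×ˢ (univ : Set unitInterval)) =>
          (z.1.1, projIcc (0 : ℝ) 1 zero_le_one (2 * (z.1.2 : ℝ) - 1)))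
        (hp.prodMk (continuous_projIcc.comp (by fun_prop))) (fun z => ⟨z.2.1, trivial⟩)
    · intro z hz
      rw [hz]
      have e1 : IccExtend zero_le_one (β z.1.1) (2 * (1 / 2 : ℝ)) = β z.1.1 1 := by
        norm_num
      have e2 : IccExtend zero_le_one (α z.1.1) (2 * (1 / 2 : ℝ) - 1) = α z.1.1 0 := by
        norm_num
      rw [e1, e2]; exact h _ z.2.1
  · rw [Set.disjoint_left] at hd
    rcases le_or_gt c (1 / 2) with hc | hc
    · have hd' : Disjoint (Ioo (2 * a) (2 * c)) (T : Set ℝ) := by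
        rw [Set.disjoint_left]
        intro x hx hxS
        refine hd (a := x / 2) ⟨by linarith [hx.1], by linarith [hx.2]⟩ ?_
        simp only [Finset.coe_insert, Finset.coe_union, Finset.coe_image]
        exact Or.inr (Or.inr ⟨x, hxS, rfl⟩)
      have key := hT (2 * a) (2 * c) (by linarith) (by linarith) (by linarith) hd'
      have hsub : ContMDiff (J.prod 𝓘(ℝ, ℝ)) 𝓘(ℝ, ℝ) ∞ (fun z : N × ℝ => 2 * z.2) :=
        ((contDiff_const.mul contDiff_id : ContDiff ℝ ∞ (fun t : ℝ => 2 * t)).contMDiff).comp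
          contMDiff_snd
      refine (key.comp (f := fun z : N × ℝ => (z.1, 2 * z.2))
        (contMDiff_fst.prodMk hsub).contMDiffOn
        (fun z hz => ⟨hz.1, by linarith [hz.2.1], by linarith [hz.2.2]⟩)).congr ?_
      intro z hz
      have hz2 : z.2 ∈ Icc (0 : ℝ) 1 := ⟨h0.trans hz.2.1, hz.2.2.trans h1⟩
      simp only [Function.comp]
      rw [IccExtend_of_mem _ _ hz2]
      simp only [LoopHolonomy.pcomp]
      rw [if_pos (hz.2.2.trans hc)]
    · have ha : 1 / 2 ≤ a := by
        by_contra! hne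
        exact hd (a := 1 / 2) ⟨hne, hc⟩ (by simp)
      have hd' : Disjoint (Ioo (2 * a - 1) (2 * c - 1)) (S : Set ℝ) := by
        rw [Set.disjoint_left]
        intro x hx hxS
        refine hd (a := (x + 1) / 2) ⟨by linarith [hx.1], by linarith [hx.2]⟩ ?_
        simp only [Finset.coe_insert, Finset.coe_union, Finset.coe_image]
        exact Or.inr (Or.inl ⟨x, hxS, rfl⟩)
      have key := hS (2 * a - 1) (2 * c - 1) (by linarith) (by linarith) (by linarith) hd'
      have hsub : ContMDiff (J.prod 𝓘(ℝ, ℝ)) 𝓘(ℝ, ℝ) ∞ (fun z : N × ℝ => 2 * z.2 - 1) :=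
        (((contDiff_const.mul contDiff_id).sub contDiff_const :
          ContDiff ℝ ∞ (fun t : ℝ => 2 * t - 1)).contMDiff).comp contMDiff_snd
      refine (key.comp (f := fun z : N × ℝ => (z.1, 2 * z.2 - 1))
        (contMDiff_fst.prodMk hsub).contMDiffOn
        (fun z hz => ⟨hz.1, by linarith [hz.2.1], by linarith [hz.2.2]⟩)).congr ?_
      intro z hz
      have hz2 : z.2 ∈ Icc (0 : ℝ) 1 := ⟨h0.trans hz.2.1, hz.2.2.trans h1⟩
      simp only [Function.comp]
      rw [IccExtend_of_mem _ _ hz2]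
      simp only [LoopHolonomy.pcomp]
      split_ifs with h12
      · have : z.2 = 1 / 2 := le_antisymm h12 (ha.trans hz.2.1)
        rw [this]
        have e1 : IccExtend zero_le_one (β z.1) (2 * (1 / 2 : ℝ)) = β z.1 1 := by
          norm_num
        have e2 : IccExtend zero_le_one (α z.1) (2 * (1 / 2 : ℝ) - 1) = α z.1 0 := by
          norm_num
        rw [e1, e2]; exact h _ hz.1
      · rfl

theorem PiecewiseSmooth.pcomp {α β : unitInterval → M} (hα : PiecewiseSmooth n α)
    (hβ : PiecewiseSmooth n β) (h : β 1 = α 0) : PiecewiseSmooth n (α ⊙ β) :=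
  ((SmoothFamilyOn.const (J := 𝓘(ℝ, ℝ)) hα (univ : Set ℝ)).pcomp (SmoothFamilyOn.const hβ univ)
    (fun _ _ => h)).piecewiseSmooth (mem_univ 0)

theorem PiecewiseSmooth.pinv {α : unitInterval → M} (hα : PiecewiseSmooth n α) :
    PiecewiseSmooth n (pinv α) :=
  (SmoothFamilyOn.const (J := 𝓘(ℝ, ℝ)) hα (univ : Set ℝ)).pinv.piecewiseSmooth (mem_univ 0)

theorem PiecewiseSmooth.const (x : M) : PiecewiseSmooth n (fun _ : unitInterval => x) :=
  ⟨continuous_const, ∅, fun _ _ _ _ _ _ => contMDiffOn_const⟩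

theorem PiecewiseSmooth.contr {p : unitInterval → M} (hp : PiecewiseSmooth n p) (i : unitInterval) :
    PiecewiseSmooth n (contr p i) := by
  classical
  by_cases hi : (i : ℝ) = 0
  · have hi' : i = 0 := Subtype.ext hi
    have : LoopHolonomy.contr p i = fun _ : unitInterval => p 0 := by
      funext j; simp [LoopHolonomy.contr, hi']
    rw [this]; exact PiecewiseSmooth.const _
  have hpos : 0 < (i : ℝ) := lt_of_le_of_ne i.2.1 (Ne.symm hi)
  obtain ⟨hc, S, hS⟩ := hp
  refine ⟨hc.comp (by fun_prop), S.image (fun s => s / (i : ℝ)), fun a c h0 hac h1 hd => ?_⟩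
  have hd' : Disjoint (Ioo (i * a) (i * c)) (S : Set ℝ) := by
    rw [Set.disjoint_left] at hd ⊢
    intro x hx hxS
    refine hd (a := x / i) ⟨?_, ?_⟩ (by
      simp only [Finset.coe_image]
      exact ⟨x, hxS, rfl⟩)
    · rw [lt_div_iff₀ hpos]; linarith [hx.1]
    · rw [div_lt_iff₀ hpos]; linarith [hx.2]
  have hi1 := i.2.2
  have key := hS (i * a) (i * c) (by positivity) (by gcongr) (by nlinarith) hd'
  have hsub : ContMDiff 𝓘(ℝ, ℝ) 𝓘(ℝ, ℝ) ∞ (fun t : ℝ => (i : ℝ) * t) :=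
    (contDiff_const.mul contDiff_id : ContDiff ℝ ∞ (fun t : ℝ => (i : ℝ) * t)).contMDiff
  refine (key.comp hsub.contMDiffOn
    (fun t ht => ⟨by simpa using mul_le_mul_of_nonneg_left ht.1 hpos.le,
      by simpa using mul_le_mul_of_nonneg_left ht.2 hpos.le⟩)).congr ?_
  intro t ht
  have ht2 : t ∈ Icc (0 : ℝ) 1 := ⟨h0.trans ht.1, ht.2.trans h1⟩
  have ht3 : (i : ℝ) * t ∈ Icc (0 : ℝ) 1 :=
    ⟨mul_nonneg hpos.le ht2.1, by nlinarith [ht2.1, ht2.2]⟩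
  simp only [Function.comp]
  rw [IccExtend_of_mem _ _ ht2, IccExtend_of_mem _ _ ht3]
  rfl

end Families

section Thin

variable {M : Type*}

theorem pcomp_range {α β : unitInterval → M} (h : β 1 = α 0) : range (α ⊙ β) = range α ∪ range β := by
  apply Subset.antisymm
  · rintro _ ⟨t, rfl⟩
    simp only [pcomp]
    split_ifs
    · exact Or.inr ⟨_, rfl⟩
    · exact Or.inl ⟨_, rfl⟩
  · rintro _ (⟨t, rfl⟩ | ⟨t, rfl⟩)
    · by_cases ht : (t : ℝ) = 0
      · have ht' : t = 0 := Subtype.ext ht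
        refine ⟨⟨1 / 2, by norm_num⟩, ?_⟩
        subst ht'
        simp [pcomp, h]
      · have hpos : 0 < (t : ℝ) := lt_of_le_of_ne t.2.1 (Ne.symm ht)
        refine ⟨⟨(t + 1) / 2, by linarith [t.2.1], by linarith [t.2.2]⟩, ?_⟩
        have : ¬ (((t : ℝ) + 1) / 2 ≤ 1 / 2) := by linarith
        simp only [pcomp]
        rw [if_neg this]
        have e : 2 * (((t : ℝ) + 1) / 2) - 1 = t := by ring
        rw [e]; simp
    · refine ⟨⟨t / 2, by linarith [t.2.1], by linarith [t.2.2]⟩, ?_⟩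
      have : (t : ℝ) / 2 ≤ 1 / 2 := by linarith [t.2.2]
      simp only [pcomp]
      rw [if_pos this]
      have e : 2 * ((t : ℝ) / 2) = t := by ring
      rw [e]; simp

theorem pinv_range (α : unitInterval → M) : range (pinv α) = range α := by
  apply Subset.antisymm
  · rintro _ ⟨t, rfl⟩; exact ⟨_, rfl⟩
  · rintro _ ⟨t, rfl⟩; exact ⟨unitInterval.symm t, by simp [pinv]⟩

@[simp] theorem pcomp_zero (α β : unitInterval → M) : (α ⊙ β) 0 = β 0 := by simp [pcomp]
@[simp] theorem pcomp_one (α β : unitInterval → M) : (α ⊙ β) 1 = α 1 := by norm_num [pcomp]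
@[simp] theorem pinv_zero (α : unitInterval → M) : pinv α 0 = α 1 := by simp [pinv]
@[simp] theorem pinv_one (α : unitInterval → M) : pinv α 1 = α 0 := by simp [pinv]

variable [TopologicalSpace M]

/-- A loop `γ` is thin if there is a homotopy of loops from `γ` to the constant loop whose image
lies in the image of `γ`. -/
def IsThin (γ : unitInterval → M) : Prop :=
  ∃ h : unitInterval × unitInterval → M, Continuous h ∧ (∀ t, h (0, t) = γ t) ∧ (∀ t, h (1, t) = γ 0) ∧
    (∀ s, h (s, 0) = γ 0 ∧ h (s, 1) = γ 0) ∧ range h ⊆ range γ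

theorem isThin_of_homotopic {R : Set M} {x : R} (L : Path x x)
    (hL : L.Homotopic (Path.refl x)) {γ : unitInterval → M} (hγ : ∀ t, γ t = (L t : M))
    (hR : R ⊆ range γ) : IsThin γ := by
  obtain ⟨h⟩ := hL
  refine ⟨fun z => (h z : M), by fun_prop, fun t => by simp [hγ], fun t => by simp [hγ],
    fun s => by simp [hγ], ?_⟩
  rintro _ ⟨z, rfl⟩
  exact hR (h z).2

/-- A path with values in `R` as a path in the subspace `R`. -/
def liftPath {R : Set M} (p : unitInterval → M) (hp : Continuous p) (hR : ∀ t, p t ∈ R) :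
    Path (⟨p 0, hR 0⟩ : R) ⟨p 1, hR 1⟩ where
  toFun t := ⟨p t, hR t⟩
  continuous_toFun := by fun_prop
  source' := rfl
  target' := rfl

theorem coe_trans {R : Set M} {x y z : R} (P : Path x y) (Q : Path y z) :
    (fun t => ((P.trans Q t : R) : M)) = (fun s => (Q s : M)) ⊙ (fun s => (P s : M)) := by
  funext t
  simp only [pcomp, Path.trans_apply]
  by_cases h : (t : ℝ) ≤ 1 / 2
  · rw [dif_pos h, if_pos h, IccExtend_of_mem]
  · rw [dif_neg h, if_neg h, IccExtend_of_mem]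

/-- Retracing: `p⁻¹ ∘ p` is thin. -/
theorem isThin_pinv_pcomp {p : unitInterval → M} (hp : Continuous p) : IsThin (pinv p ⊙ p) := by
  let P := liftPath (R := range p) p hp (fun t => ⟨t, rfl⟩)
  refine isThin_of_homotopic (P.trans P.symm) ?_ (fun t => ?_) ?_
  · rw [← Path.Homotopic.Quotient.eq]; simp
  · exact (congrFun (coe_trans P P.symm) t).symm
  · rw [pcomp_range (by simp), pinv_range, union_self]

theorem isThin_triangle {p q r : unitInterval → M} (hp : Continuous p) (hq : Continuous q)
    (hr : Continuous r) (h0q : q 0 = p 0) (h0r : r 0 = p 0) (h1q : q 1 = p 1) (h1r : r 1 = p 1) :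
    IsThin (pinv (pinv p ⊙ r) ⊙ ((pinv p ⊙ q) ⊙ (pinv q ⊙ r))) := by
  let R := range p ∪ range q ∪ range r
  let P := liftPath (R := R) p hp (fun t => Or.inl (Or.inl ⟨t, rfl⟩))
  let Q := (liftPath (R := R) q hq (fun t => Or.inl (Or.inr ⟨t, rfl⟩))).cast
    (x' := ⟨p 0, Or.inl (Or.inl ⟨0, rfl⟩)⟩) (y' := ⟨p 1, Or.inl (Or.inl ⟨1, rfl⟩)⟩)
    (Subtype.ext h0q.symm) (Subtype.ext h1q.symm)
  let S := (liftPath (R := R) r hr (fun t => Or.inr ⟨t, rfl⟩)).cast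
    (x' := ⟨p 0, Or.inl (Or.inl ⟨0, rfl⟩)⟩) (y' := ⟨p 1, Or.inl (Or.inl ⟨1, rfl⟩)⟩)
    (Subtype.ext h0r.symm) (Subtype.ext h1r.symm)
  refine isThin_of_homotopic (((S.trans Q.symm).trans (Q.trans P.symm)).trans
    (S.trans P.symm).symm) ?_ (fun t => ?_) ?_
  · rw [← Path.Homotopic.Quotient.eq]
    simp only [Path.Homotopic.Quotient.mk_trans, Path.Homotopic.Quotient.mk_symm,
      Path.Homotopic.Quotient.mk_refl]
    rw [Path.Homotopic.Quotient.trans_assoc (Path.Homotopic.Quotient.mk S) _ _,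
      ← Path.Homotopic.Quotient.trans_assoc _ (Path.Homotopic.Quotient.mk Q) _,
      Path.Homotopic.Quotient.symm_trans, Path.Homotopic.Quotient.refl_trans,
      Path.Homotopic.Quotient.trans_symm]
  · have e1 := coe_trans S Q.symm
    have e2 := coe_trans Q P.symm
    have e3 := coe_trans S P.symm
    have e4 := coe_trans (S.trans Q.symm) (Q.trans P.symm)
    rw [e1, e2] at e4
    have e5 := coe_trans ((S.trans Q.symm).trans (Q.trans P.symm)) (S.trans P.symm).symm
    have e6 : (fun s => (((S.trans P.symm).symm s : R) : M)) =
      pinv (fun s => ((S.trans P.symm s : R) : M)) := rfl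
    rw [e4, e6, e3] at e5
    exact (congrFun e5 t).symm
  · have h1 : (pinv q ⊙ r) 1 = (pinv p ⊙ q) 0 := by simp
    have h2 : ((pinv p ⊙ q) ⊙ (pinv q ⊙ r)) 1 = pinv (pinv p ⊙ r) 0 := by simp
    rw [pcomp_range h2, pinv_range, pcomp_range h1, pcomp_range (by simp [h1r]),
      pcomp_range (by simp [h1q]), pcomp_range (by simp [h1q, h1r]), pinv_range, pinv_range]
    intro x hx
    simp only [R, mem_union] at hx ⊢
    tauto

end Thin


section Holonomy

variable (n d : ℕ) {M : Type*} [TopologicalSpace M] [ChartedSpace (Euc n) M] (b : M)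

/-- The space `PM` of piecewise smooth paths starting at the base point. -/
structure BasedPath where
  toFun : unitInterval → M
  smooth : PiecewiseSmooth n toFun
  source : toFun 0 = b

/-- The space `ΩM` of piecewise smooth loops at the base point. -/
structure BasedLoop extends BasedPath n b where
  target : toFun 1 = b

instance : CoeFun (BasedPath n b) (fun _ => unitInterval → M) := ⟨BasedPath.toFun⟩
instance : CoeFun (BasedLoop n b) (fun _ => unitInterval → M) := ⟨fun γ => γ.toFun⟩

/-- The constant path. -/
def constPath : BasedPath n b := ⟨fun _ => b, PiecewiseSmooth.const b, rfl⟩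

variable {n b}

/-- The composition `α ∘ β` of loops (first `β`, then `α`). -/
noncomputable def BasedLoop.comp (α β : BasedLoop n b) : BasedLoop n b where
  toFun := α ⊙ β
  smooth := α.smooth.pcomp β.smooth (β.target.trans α.source.symm)
  source := by simpa using β.source
  target := by simpa using α.target

/-- `K(p,i)` as an element of `PM`. -/
def BasedPath.contr (p : BasedPath n b) (i : unitInterval) : BasedPath n b where
  toFun := LoopHolonomy.contr p i
  smooth := p.smooth.contr i
  source := by simpa [LoopHolonomy.contr] using p.source

variable (n b)

/-- The set of axiomatic holonomy maps `H : ΩM → G`. -/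
structure HolonomyMap (G : Type*) [Group G] [TopologicalSpace G] [ChartedSpace (Euc d) G] where
  toFun : BasedLoop n b → G
  map_comp : ∀ α β : BasedLoop n b, toFun (α.comp β) = toFun β * toFun α
  map_thin : ∀ α : BasedLoop n b, IsThin α → toFun α = 1
  smooth : ∀ (m : ℕ) (U : Set (Euc m)), IsOpen U → ∀ Ω : Euc m → BasedLoop n b,
    SmoothFamilyOn n (𝓡 m) U (fun u => (Ω u : unitInterval → M)) →
      ContMDiffOn (𝓡 m) (𝓡 d) ∞ (fun u => toFun (Ω u)) U

variable {n d b} {G : Type*} [Group G] [TopologicalSpace G] [ChartedSpace (Euc d) G]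

namespace HolonomyMap

variable (H : HolonomyMap n d b G)

open Classical in
/-- The value of `H` on a map `γ : [0,1] → M`; it is only meaningful (and set to `1` otherwise)
if `γ` is a piecewise smooth loop at the base point. -/
noncomputable def val (γ : unitInterval → M) : G :=
  if h : PiecewiseSmooth n γ ∧ γ 0 = b ∧ γ 1 = b then H.toFun ⟨⟨γ, h.1, h.2.1⟩, h.2.2⟩ else 1

theorem val_eq {γ : unitInterval → M} (h1 : PiecewiseSmooth n γ) (h2 : γ 0 = b) (h3 : γ 1 = b) :
    H.val γ = H.toFun ⟨⟨γ, h1, h2⟩, h3⟩ := by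
  simp [val, h1, h2, h3]

theorem val_pcomp {α β : unitInterval → M} (hα : PiecewiseSmooth n α) (hα0 : α 0 = b) (hα1 : α 1 = b)
    (hβ : PiecewiseSmooth n β) (hβ0 : β 0 = b) (hβ1 : β 1 = b) :
    H.val (α ⊙ β) = H.val β * H.val α := by
  rw [H.val_eq hα hα0 hα1, H.val_eq hβ hβ0 hβ1, ← H.map_comp,
    H.val_eq (hα.pcomp hβ (hβ1.trans hα0.symm)) (by simpa using hβ0) (by simpa using hα1)]
  rfl

theorem val_thin {α : unitInterval → M} (h : IsThin α) : H.val α = 1 := by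
  unfold val
  split_ifs with h'
  · exact H.map_thin _ h
  · rfl

theorem smooth_diff {p q : BasedPath n b} (h : q 1 = p 1) :
    PiecewiseSmooth n (pinv p ⊙ q) := p.smooth.pinv.pcomp q.smooth (by simpa using h)

theorem val_self (p : BasedPath n b) : H.val (pinv p ⊙ p) = 1 :=
  H.val_thin (isThin_pinv_pcomp p.smooth.1)

theorem val_trans {p q r : BasedPath n b} (hq : q 1 = p 1) (hr : r 1 = p 1) :
    H.val (pinv q ⊙ r) * H.val (pinv p ⊙ q) = H.val (pinv p ⊙ r) := by
  have hqr : PiecewiseSmooth n (pinv q ⊙ r) := smooth_diff (hr.trans hq.symm)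
  have hpq : PiecewiseSmooth n (pinv p ⊙ q) := smooth_diff hq
  have hpr : PiecewiseSmooth n (pinv p ⊙ r) := smooth_diff hr
  have hp0 := p.source
  have hq0 := q.source
  have hr0 := r.source
  have htri : PiecewiseSmooth n ((pinv p ⊙ q) ⊙ (pinv q ⊙ r)) :=
    hpq.pcomp hqr (by simp [hq0])
  have h1 := H.val_thin (isThin_triangle p.smooth.1 q.smooth.1 r.smooth.1 (hq0.trans hp0.symm)
    (hr0.trans hp0.symm) hq hr)
  have h2 := H.val_thin (isThin_pinv_pcomp hpr.1)
  rw [H.val_pcomp hpr.pinv (by simp [hp0]) (by simp [hr0]) htri (by simp [hr0])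
    (by simp [hp0]), H.val_pcomp hpq (by simp [hq0]) (by simp [hp0]) hqr (by simp [hr0])
    (by simp [hq0])] at h1
  rw [H.val_pcomp hpr.pinv (by simp [hp0]) (by simp [hr0]) hpr (by simp [hr0])
    (by simp [hp0])] at h2
  exact mul_right_cancel (h1.trans h2.symm)

/-- The equivalence relation `T` on `PM × G`: `(p,g) T (p',g')` iff `p(1) = p'(1)` and
`g' = H(p⁻¹ ∘ p') g`. -/
@[reducible] def setoid : Setoid (BasedPath n b × G) where
  r x y := x.1 1 = y.1 1 ∧ y.2 = H.val (pinv x.1 ⊙ y.1) * x.2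
  iseqv := by
    refine ⟨fun x => ⟨rfl, by simp [H.val_self]⟩, ?_, ?_⟩
    · rintro x y ⟨h1, h2⟩
      refine ⟨h1.symm, ?_⟩
      rw [h2, ← mul_assoc, H.val_trans h1.symm rfl, H.val_self, one_mul]
    · rintro x y z ⟨h1, h2⟩ ⟨h3, h4⟩
      refine ⟨h1.trans h3, ?_⟩
      rw [h4, h2, ← mul_assoc, H.val_trans h1.symm (h1.trans h3).symm]

/-- The total space `E = (PM × G)/T` of the reconstructed bundle. -/
def Total : Type _ := Quotient H.setoid

/-- The class `{p,g}`. -/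
def cls (p : BasedPath n b) (g : G) : H.Total := Quotient.mk H.setoid (p, g)

theorem cls_eq_cls {p p' : BasedPath n b} {g g' : G} :
    H.cls p g = H.cls p' g' ↔ p 1 = p' 1 ∧ g' = H.val (pinv p ⊙ p') * g := Quotient.eq

/-- The projection `π{p,g} = p(1)`. -/
def proj : H.Total → M :=
  Quotient.lift (fun x : BasedPath n b × G => x.1 1) (fun _ _ h => h.1)

/-- The right action `{p,h} g = {p,hg}`. -/
def act (a : H.Total) (g : G) : H.Total :=
  Quotient.map (fun x : BasedPath n b × G => (x.1, x.2 * g))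
    (fun x y h => ⟨And.left h, by
      have h2 : y.2 = H.val (pinv x.1 ⊙ y.1) * x.2 := And.right h
      simp only [h2, mul_assoc]⟩) a

theorem exists_rep (a : H.Total) : ∃ x : BasedPath n b × G, H.cls x.1 x.2 = a := by
  induction a using Quotient.ind with | _ x => exact ⟨x, rfl⟩

/-- A representative of a class. -/
noncomputable def rep (a : H.Total) : BasedPath n b × G := (H.exists_rep a).choose

theorem cls_rep (a : H.Total) : H.cls (H.rep a).1 (H.rep a).2 = a := (H.exists_rep a).choose_spec

end HolonomyMap

variable (n b)

/-- A smooth family of paths `ψ : U → PM` on an open set `U ⊆ M` with `ψ[u](1) = u`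
(the values of `toFun` outside `U` are irrelevant). -/
structure LocalFamily where
  U : Set M
  isOpen : IsOpen U
  toFun : M → BasedPath n b
  smooth : SmoothFamilyOn n (𝓡 n) U (fun u => (toFun u : unitInterval → M))
  tip : ∀ u ∈ U, toFun u 1 = u

instance : CoeFun (LocalFamily n b) (fun _ => M → BasedPath n b) := ⟨LocalFamily.toFun⟩


variable {n b}

namespace HolonomyMap

variable (H : HolonomyMap n d b G)

/-- The topology of `E`: the final topology for the local trivializations
`C_ψ : U × G → E`, `C_ψ(u,g) = {ψ[u],g}`. -/
instance : TopologicalSpace H.Total :=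
  ⨆ ψ : LocalFamily n b, TopologicalSpace.coinduced
    (fun z : ψ.U × G => H.cls (ψ z.1) z.2) inferInstance

/-- The second component of `C_ψ⁻¹`: `{p,g} ↦ H(p⁻¹ ∘ ψ[p(1)]) g`. -/
noncomputable def coord (ψ : LocalFamily n b) (a : H.Total) : G :=
  H.val (pinv (H.rep a).1 ⊙ (ψ (H.proj a) : unitInterval → M)) * (H.rep a).2

theorem coord_cls (ψ : LocalFamily n b) {p : BasedPath n b} (hp : p 1 ∈ ψ.U) (g : G) :
    H.coord ψ (H.cls p g) = H.val (pinv p ⊙ (ψ (p 1) : unitInterval → M)) * g := by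
  obtain ⟨h1, h2⟩ := H.cls_eq_cls.1 (H.cls_rep (H.cls p g))
  rw [coord]
  generalize H.rep (H.cls p g) = x at h1 h2
  subst h2
  rw [← mul_assoc, H.val_trans h1.symm]
  · rfl
  · rw [h1]; exact ψ.tip _ hp

theorem isOpen_proj_preimage (ψ : LocalFamily n b) : IsOpen (H.proj ⁻¹' ψ.U) := by
  refine isOpen_iSup_iff.2 (fun ψ' => isOpen_coinduced.2 ?_)
  have : (fun z : ψ'.U × G => H.cls (ψ' z.1) z.2) ⁻¹' (H.proj ⁻¹' ψ.U) =
      {z : ψ'.U × G | (z.1 : M) ∈ ψ.U} := by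
    ext z
    change ψ' z.1 1 ∈ ψ.U ↔ (z.1 : M) ∈ ψ.U
    rw [ψ'.tip _ z.1.2]
  rw [this]
  exact ψ.isOpen.preimage (by fun_prop)

end HolonomyMap

variable [IsManifold (𝓡 n) ∞ M]

theorem exists_segments (m : M) : ∃ U : Set M, IsOpen U ∧ m ∈ U ∧ ∃ σ : M → unitInterval → M,
    SmoothFamilyOn n (𝓡 n) U σ ∧ ∀ u ∈ U, σ u 0 = m ∧ σ u 1 = u := by
  let c := chartAt (Euc n) m
  obtain ⟨ε, hε, hball⟩ := Metric.isOpen_iff.1 c.open_target (c m) (mem_chart_target _ m)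
  have hsrc : ContMDiffOn (𝓡 n) (𝓡 n) ∞ c c.source := contMDiffOn_chart
  have htgt : ContMDiffOn (𝓡 n) (𝓡 n) ∞ c.symm c.target := contMDiffOn_chart_symm
  let U := c.source ∩ c ⁻¹' Metric.ball (c m) ε
  have hU : IsOpen U := c.isOpen_inter_preimage Metric.isOpen_ball
  let τ : M → ℝ → Euc n := fun u t => c m + t • (c u - c m)
  have hmem : ∀ u ∈ U, ∀ t ∈ Icc (0 : ℝ) 1, τ u t ∈ c.target := by
    intro u hu t ht
    refine hball ?_
    have h1 : ‖c u - c m‖ < ε := by rw [← dist_eq_norm]; exact hu.2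
    simp only [τ, Metric.mem_ball, dist_self_add_left, norm_smul, Real.norm_eq_abs,
      abs_of_nonneg ht.1]
    nlinarith [norm_nonneg (c u - c m), ht.1, ht.2]
  have hτ : ContMDiffOn ((𝓡 n).prod 𝓘(ℝ, ℝ)) (𝓡 n) ∞ (fun z : M × ℝ => τ z.1 z.2)
      (U ×ˢ univ) := by
    have hc : ContMDiffOn ((𝓡 n).prod 𝓘(ℝ, ℝ)) (𝓡 n) ∞ (fun z : M × ℝ => c z.1)
        (U ×ˢ univ) := hsrc.comp contMDiff_fst.contMDiffOn (fun z hz => hz.1.1)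
    have h2 : ContMDiffOn ((𝓡 n).prod 𝓘(ℝ, ℝ)) 𝓘(ℝ, ℝ) ∞ (fun z : M × ℝ => z.2)
        (U ×ˢ univ) := contMDiff_snd.contMDiffOn
    exact contMDiffOn_const.add (h2.smul (hc.sub contMDiffOn_const))
  refine ⟨U, hU, ⟨mem_chart_source _ m, Metric.mem_ball_self hε⟩,
    fun u t => c.symm (τ u t), ⟨?_, ∅, ?_⟩, ?_⟩
  · refine htgt.continuousOn.comp (f := fun z : M × unitInterval => τ z.1 z.2) ?_
      (fun z hz => hmem _ hz.1 _ z.2.2)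
    exact hτ.continuousOn.comp (f := fun z : M × unitInterval => (z.1, (z.2 : ℝ)))
      (by fun_prop) (fun z hz => ⟨hz.1, trivial⟩)
  · intro a e h0 _ h1 _
    have : ContMDiffOn ((𝓡 n).prod 𝓘(ℝ, ℝ)) (𝓡 n) ∞ (fun z : M × ℝ => c.symm (τ z.1 z.2))
        (U ×ˢ Icc a e) :=
      htgt.comp (hτ.mono (prod_mono Subset.rfl (subset_univ _)))
        (fun z hz => hmem _ hz.1 _ ⟨h0.trans hz.2.1, hz.2.2.trans h1⟩)
    refine this.congr (fun z hz => ?_)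
    rw [IccExtend_of_mem _ _ ⟨h0.trans hz.2.1, hz.2.2.trans h1⟩]
  · intro u hu
    refine ⟨?_, ?_⟩
    · simp [τ, c]
    · simp [τ, c.left_inv hu.1]

theorem exists_basedPath [ConnectedSpace M] (x : M) : ∃ p : BasedPath n b, p 1 = x := by
  let S : Set M := {x | ∃ p : BasedPath n b, p 1 = x}
  suffices h : S = univ by
    have : x ∈ S := h ▸ mem_univ x
    exact this
  refine IsClopen.eq_univ ⟨⟨?_⟩, ?_⟩ ⟨b, constPath n b, rfl⟩
  · rw [isOpen_iff_mem_nhds]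
    intro m hm
    obtain ⟨U, hU, hmU, σ, hσ, hend⟩ := exists_segments (n := n) m
    filter_upwards [hU.mem_nhds hmU] with u hu
    rintro ⟨p, hp⟩
    refine hm ⟨⟨pinv (σ u) ⊙ p, (hσ.piecewiseSmooth hu).pinv.pcomp p.smooth ?_, ?_⟩, ?_⟩
    · simp [hp, hend u hu]
    · simp [p.source]
    · simp [hend u hu]
  · rw [isOpen_iff_mem_nhds]
    rintro m ⟨p, hp⟩
    obtain ⟨U, hU, hmU, σ, hσ, hend⟩ := exists_segments (n := n) m
    filter_upwards [hU.mem_nhds hmU] with u hu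
    refine ⟨⟨σ u ⊙ p, (hσ.piecewiseSmooth hu).pcomp p.smooth ?_, ?_⟩, ?_⟩
    · simp [hp, hend u hu]
    · simp [p.source]
    · simp [hend u hu]

theorem exists_localFamily [ConnectedSpace M] (m : M) : ∃ ψ : LocalFamily n b, m ∈ ψ.U := by
  classical
  obtain ⟨p, hp⟩ := exists_basedPath (n := n) (b := b) m
  obtain ⟨U, hU, hmU, σ, hσ, hend⟩ := exists_segments (n := n) m
  have hfam : SmoothFamilyOn n (𝓡 n) U (fun u => σ u ⊙ (p : unitInterval → M)) :=
    hσ.pcomp (SmoothFamilyOn.const p.smooth U) (fun u hu => by simp [hp, hend u hu])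
  refine ⟨⟨U, hU, fun u => if hu : u ∈ U then
      ⟨σ u ⊙ p, hfam.piecewiseSmooth hu, by simp [p.source]⟩ else constPath n b, ?_, ?_⟩, hmU⟩
  · exact hfam.congr (fun u hu => by simp [hu])
  · intro u hu; simp [hu, hend u hu]

namespace HolonomyMap

variable (H : HolonomyMap n d b G)

theorem contMDiffOn_val {U : Set M} (hU : IsOpen U) {w : M → unitInterval → M}
    (hw : SmoothFamilyOn n (𝓡 n) U w) (h0 : ∀ u ∈ U, w u 0 = b) (h1 : ∀ u ∈ U, w u 1 = b) :
    ContMDiffOn (𝓡 n) (𝓡 d) ∞ (fun u => H.val (w u)) U := by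
  classical
  intro x hx
  let c := chartAt (Euc n) x
  let V : Set (Euc n) := c.target ∩ c.symm ⁻¹' U
  have hV : IsOpen V := c.isOpen_inter_preimage_symm hU
  have hfam : SmoothFamilyOn n (𝓡 n) V (fun v => w (c.symm v)) :=
    hw.comp ((contMDiffOn_chart_symm (I := 𝓡 n) (n := ∞) (x := x)).mono inter_subset_left)
      (fun v hv => hv.2)
  let Ω : Euc n → BasedLoop n b := fun v =>
    if hv : v ∈ V then ⟨⟨w (c.symm v), hfam.piecewiseSmooth hv, h0 _ hv.2⟩, h1 _ hv.2⟩
    else ⟨constPath n b, rfl⟩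
  have hΩ : ∀ v ∈ V, (Ω v : unitInterval → M) = w (c.symm v) := fun v hv => by simp [Ω, hv]
  have key := H.smooth n V hV Ω (hfam.congr hΩ)
  have key2 : ContMDiffOn (𝓡 n) (𝓡 d) ∞ (fun v => H.val (w (c.symm v))) V := by
    refine key.congr (fun v hv => ?_)
    rw [H.val_eq (hfam.piecewiseSmooth hv) (h0 _ hv.2) (h1 _ hv.2)]
    simp [Ω, hv]
  have hW : c.source ∩ U ∈ 𝓝 x := (c.open_source.inter hU).mem_nhds ⟨mem_chart_source _ x, hx⟩
  have key3 : ContMDiffOn (𝓡 n) (𝓡 d) ∞ (fun u => H.val (w (c.symm (c u)))) (c.source ∩ U) := by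
    refine key2.comp ((contMDiffOn_chart (I := 𝓡 n) (n := ∞) (x := x)).mono inter_subset_left) ?_
    intro u hu
    exact ⟨c.map_source hu.1, by simpa [c.left_inv hu.1] using hu.2⟩
  have key4 : ContMDiffOn (𝓡 n) (𝓡 d) ∞ (fun u => H.val (w u)) (c.source ∩ U) :=
    key3.congr (fun u hu => by rw [c.left_inv hu.1])
  exact (key4.contMDiffAt hW).contMDiffWithinAt

theorem contMDiffOn_transition (ψ ψ' : LocalFamily n b) :
    ContMDiffOn (𝓡 n) (𝓡 d) ∞ (fun x => H.val (pinv (ψ x) ⊙ (ψ' x : unitInterval → M))) (ψ.U ∩ ψ'.U) := by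
  have h1 := ψ.smooth.mono (inter_subset_left (t := ψ'.U))
  have h2 := ψ'.smooth.mono (inter_subset_right (s := ψ.U))
  refine H.contMDiffOn_val (ψ.isOpen.inter ψ'.isOpen) (h1.pinv.pcomp h2 ?_) ?_ ?_
  · intro u hu; simp [ψ.tip u hu.1, ψ'.tip u hu.2]
  · intro u hu; simp [(ψ' u).source]
  · intro u hu; simp [(ψ u).source]

variable [LieGroup (𝓡 d) ∞ G]

/-- The inverse `C_ψ⁻¹ : π⁻¹(U) → U × G` of a local trivialization `C_ψ(u,g) = {ψ[u],g}`. -/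
noncomputable def localTriv (ψ : LocalFamily n b) : OpenPartialHomeomorph H.Total (M × G) where
  toFun a := (H.proj a, H.coord ψ a)
  invFun z := H.cls (ψ z.1) z.2
  source := H.proj ⁻¹' ψ.U
  target := ψ.U ×ˢ univ
  map_source' a ha := ⟨ha, trivial⟩
  map_target' z hz := by
    change ψ z.1 1 ∈ ψ.U
    rw [ψ.tip _ hz.1]; exact hz.1
  left_inv' a ha := by
    obtain ⟨⟨p, g⟩, rfl⟩ := H.exists_rep a
    have hp : p 1 ∈ ψ.U := ha
    rw [H.coord_cls ψ hp]
    refine (H.cls_eq_cls.2 ⟨(ψ.tip _ hp).symm, rfl⟩).symm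
  right_inv' z hz := by
    have h1 : ψ z.1 1 = z.1 := ψ.tip _ hz.1
    have h2 : H.proj (H.cls (ψ z.1) z.2) = z.1 := h1
    refine Prod.ext h2 ?_
    change H.coord ψ (H.cls (ψ z.1) z.2) = z.2
    rw [H.coord_cls ψ (by rw [h1]; exact hz.1), h1, H.val_self, one_mul]
  open_source := H.isOpen_proj_preimage ψ
  open_target := ψ.isOpen.prod isOpen_univ
  continuousOn_toFun := by
    have : ContMDiffMul (𝓡 d) ∞ G := inferInstance
    have : ContinuousMul G := continuousMul_of_contMDiffMul (𝓡 d) ∞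
    have hsrc : IsOpen (H.proj ⁻¹' ψ.U) := H.isOpen_proj_preimage ψ
    refine (continuousOn_open_iff hsrc).2 fun s hs => ?_
    refine isOpen_iSup_iff.2 (fun ψ' => isOpen_coinduced.2 ?_)
    have hc : ContinuousOn (fun z : ψ'.U × G =>
        ((z.1 : M), H.val (pinv (ψ' z.1) ⊙ (ψ z.1 : unitInterval → M)) * z.2))
        {z : ψ'.U × G | (z.1 : M) ∈ ψ.U} := by
      refine ContinuousOn.prodMk (by fun_prop) (ContinuousOn.mul ?_ (by fun_prop))
      exact (H.contMDiffOn_transition ψ' ψ).continuousOn.comp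
        (f := fun z : ψ'.U × G => (z.1 : M)) (by fun_prop) (fun z hz => ⟨z.1.2, hz⟩)
    have ho : IsOpen {z : ψ'.U × G | (z.1 : M) ∈ ψ.U} := ψ.isOpen.preimage (by fun_prop)
    convert hc.isOpen_inter_preimage ho hs using 1
    ext z
    have e1 : ψ' z.1 1 = z.1 := ψ'.tip _ z.1.2
    have e2 : H.proj (H.cls (ψ' z.1) z.2) = z.1 := e1
    simp only [mem_inter_iff, mem_preimage, mem_ofPred_eq, e2]
    refine and_congr_right fun hz => ?_
    rw [H.coord_cls ψ (by rw [e1]; exact hz), e1]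
  continuousOn_invFun := by
    have hc : Continuous (fun z : ψ.U × G => H.cls (ψ z.1) z.2) :=
      continuous_iff_coinduced_le.2
        (le_iSup (fun ψ : LocalFamily n b => TopologicalSpace.coinduced
          (fun z : ψ.U × G => H.cls (ψ z.1) z.2) inferInstance) ψ)
    rw [continuousOn_iff_continuous_domRestrict]
    exact hc.comp (f := fun z : ↥(ψ.U ×ˢ (univ : Set G)) => ((⟨z.1.1, z.2.1⟩ : ψ.U), z.1.2))
      (by fun_prop)


/-- The differential structure of `E`: its charts are the inverses of the local trivializations
followed by the charts of `M × G`. -/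
noncomputable instance [ConnectedSpace M] :
    ChartedSpace (ModelProd (Euc n) (Euc d)) H.Total where
  atlas := {e | ∃ ψ : LocalFamily n b, ∃ c ∈ atlas (ModelProd (Euc n) (Euc d)) (M × G),
    e = H.localTriv ψ ≫ₕ c}
  chartAt a := H.localTriv (exists_localFamily (n := n) (b := b) (H.proj a)).choose ≫ₕ
    chartAt (ModelProd (Euc n) (Euc d))
      (H.localTriv (exists_localFamily (n := n) (b := b) (H.proj a)).choose a)
  mem_chart_source a := by
    rw [OpenPartialHomeomorph.trans_source]
    exact ⟨(exists_localFamily (n := n) (b := b) (H.proj a)).choose_spec,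
      mem_chart_source (ModelProd (Euc n) (Euc d)) (H.localTriv _ a)⟩
  chart_mem_atlas a := ⟨_, _, chart_mem_atlas _ _, rfl⟩

theorem contMDiffOn_localTriv_trans (ψ ψ' : LocalFamily n b) :
    ContMDiffOn ((𝓡 n).prod (𝓡 d)) ((𝓡 n).prod (𝓡 d)) ∞
      ((H.localTriv ψ).symm ≫ₕ H.localTriv ψ') ((H.localTriv ψ).symm ≫ₕ H.localTriv ψ').source := by
  have hs : ((H.localTriv ψ).symm ≫ₕ H.localTriv ψ').source ⊆ (ψ.U ∩ ψ'.U) ×ˢ univ := by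
    rw [OpenPartialHomeomorph.trans_source]
    rintro z ⟨h1, h2⟩
    have h1' : z.1 ∈ ψ.U := h1.1
    have h2' : ψ z.1 1 ∈ ψ'.U := h2
    rw [ψ.tip _ h1'] at h2'
    exact ⟨⟨h1', h2'⟩, trivial⟩
  have h : ContMDiffOn ((𝓡 n).prod (𝓡 d)) ((𝓡 n).prod (𝓡 d)) ∞
      (fun z : M × G => (z.1, H.val (pinv (ψ z.1) ⊙ (ψ' z.1 : unitInterval → M)) * z.2))
      ((ψ.U ∩ ψ'.U) ×ˢ univ) := by
    refine contMDiff_fst.contMDiffOn.prodMk (ContMDiffOn.mul ?_ contMDiff_snd.contMDiffOn)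
    exact (H.contMDiffOn_transition ψ ψ').comp (f := fun z : M × G => z.1)
      contMDiff_fst.contMDiffOn (fun z hz => hz.1)
  refine (h.mono hs).congr (fun z hz => ?_)
  have hz' := (hs hz).1
  have e1 : ψ z.1 1 = z.1 := ψ.tip _ hz'.1
  refine Prod.ext e1 ?_
  change H.coord ψ' (H.cls (ψ z.1) z.2) = _
  rw [H.coord_cls ψ' (by rw [e1]; exact hz'.2), e1]

instance [ConnectedSpace M] : IsManifold ((𝓡 n).prod (𝓡 d)) ∞ H.Total := by
  have : ContMDiffMul (𝓡 d) ∞ G := inferInstance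
  have : IsManifold (𝓡 d) ∞ G := this.toIsManifold
  refine isManifold_of_contDiffOn _ _ _ ?_
  rintro _ _ ⟨ψ, c, hc, rfl⟩ ⟨ψ', c', hc', rfl⟩
  have h1 := contMDiffOn_symm_of_mem_maximalAtlas (I := (𝓡 n).prod (𝓡 d)) (n := ∞)
    (StructureGroupoid.subset_maximalAtlas _ hc)
  have h2 := contMDiffOn_of_mem_maximalAtlas (I := (𝓡 n).prod (𝓡 d)) (n := ∞)
    (StructureGroupoid.subset_maximalAtlas _ hc')
  have h3 := H.contMDiffOn_localTriv_trans ψ ψ'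
  have h4 : ContMDiffOn ((𝓡 n).prod (𝓡 d)) ((𝓡 n).prod (𝓡 d)) ∞
      ((H.localTriv ψ ≫ₕ c).symm ≫ₕ (H.localTriv ψ' ≫ₕ c'))
      ((H.localTriv ψ ≫ₕ c).symm ≫ₕ (H.localTriv ψ' ≫ₕ c')).source := by
    refine h2.comp (h3.comp (h1.mono ?_) ?_) ?_
    · intro z hz
      simp only [mfld_simps] at hz ⊢
      tauto
    · intro z hz
      simp only [mfld_simps] at hz ⊢
      tauto
    · intro z hz
      simp only [mfld_simps] at hz ⊢
      tauto
  rw [← contMDiffOn_iff_contDiffOn]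
  refine ((𝓡 n).prod (𝓡 d)).contMDiff.comp_contMDiffOn
    (h4.comp (((𝓡 n).prod (𝓡 d)).contMDiffOn_symm.mono inter_subset_right) ?_)
  intro z hz
  exact hz.1

variable [ConnectedSpace M]

/-- The velocity `d/di c(i)` at `i = j` of a curve in `E`. -/
noncomputable def velocity (c : ℝ → H.Total) (j : ℝ) :
    TangentSpace ((𝓡 n).prod (𝓡 d)) (c j) :=
  mfderiv 𝓘(ℝ, ℝ) ((𝓡 n).prod (𝓡 d)) c j (1 : ℝ)

/-- The vertical subspace `ker π_*` of `T_a E`. -/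
noncomputable def vertical (a : H.Total) :
    Submodule ℝ (TangentSpace ((𝓡 n).prod (𝓡 d)) a) :=
  LinearMap.ker (mfderiv ((𝓡 n).prod (𝓡 d)) (𝓡 n) H.proj a).toLinearMap

/-- The subspace `Γ_a` of `T_a E` generated by the vectors `d/di {K(r,i),h}` at `i = j`, where
`r ∈ PM` is smooth near `0 < j < 1` and `{K(r,j),h} = a`. For `a = {p,g}` the last condition says
that `r(j) = p(1)` and `h = H(p⁻¹ ∘ K(r,j)) g`. -/
noncomputable def horizontal (a : H.Total) :
    Submodule ℝ (TangentSpace ((𝓡 n).prod (𝓡 d)) a) :=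
  Submodule.span ℝ {X | ∃ (r : BasedPath n b) (j : ℝ) (h : G), j ∈ Ioo (0 : ℝ) 1 ∧
    (∀ᶠ t in 𝓝 j, ContMDiffAt 𝓘(ℝ, ℝ) (𝓡 n) ∞ (IccExtend zero_le_one (r : unitInterval → M)) t) ∧
    H.cls (r.contr (projIcc 0 1 zero_le_one j)) h = a ∧
    X = H.velocity (fun i => H.cls (r.contr (projIcc 0 1 zero_le_one i)) h) j}

open Classical in
/-- The projection `P_V` of `T_a E` onto the vertical subspace along `Γ_a`; it is meaningful
(and set to `0` otherwise) if these two subspaces are complementary. -/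
noncomputable def vertProj (a : H.Total) (X : TangentSpace ((𝓡 n).prod (𝓡 d)) a) :
    TangentSpace ((𝓡 n).prod (𝓡 d)) a :=
  if h : IsCompl (H.vertical a) (H.horizontal a) then
    ((H.vertical a).projectionOnto (H.horizontal a) h X : H.vertical a) else 0

/-- The differential at `e` of the map `G → E`, `g ↦ ag`. -/
noncomputable def orbitDeriv (a : H.Total) (ξ : GroupLieAlgebra (𝓡 d) G) :
    TangentSpace ((𝓡 n).prod (𝓡 d)) a :=
  mfderiv (𝓡 d) ((𝓡 n).prod (𝓡 d)) (fun g : G => H.act a g) 1 ξ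

/-- The connection 1-form `ω_a X = (a⁻¹)_* P_V X`. Since `a⁻¹` is the inverse of the
diffeomorphism `G → π⁻¹(π(a))`, `g ↦ ag`, its differential is the inverse of `orbitDeriv a`. -/
noncomputable def connForm (a : H.Total) (X : TangentSpace ((𝓡 n).prod (𝓡 d)) a) :
    GroupLieAlgebra (𝓡 d) G :=
  Function.invFun (H.orbitDeriv a) (H.vertProj a X)

/-- The local section `σ(x) = C_ψ(x,e)`. -/
def localSection (ψ : LocalFamily n b) (x : M) : H.Total := H.cls (ψ x) 1

/-- The local coefficient `A_μ(x) = ω_{σ(x)} (σ_* ∂_μ(x))`, where `∂_μ` is the coordinate vector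
field of the chart `φ`. -/
noncomputable def localCoeff (ψ : LocalFamily n b) (φ : OpenPartialHomeomorph M (Euc n))
    (μ : Fin n) (x : M) : GroupLieAlgebra (𝓡 d) G :=
  H.connForm (H.localSection ψ x)
    (mfderiv (𝓡 n) ((𝓡 n).prod (𝓡 d)) (H.localSection ψ) x
      (mfderiv (𝓡 n) (𝓡 n) φ.symm (φ x) (EuclideanSpace.single μ (1 : ℝ))))

end HolonomyMap

/-- The curve `i ↦ (χ[i],g(i))` in `PM × G` on `[0,1]` has a piecewise smooth curve of end points
`i ↦ χ[i](1)`, and it is smooth near the interior parameter `j`. -/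
def SmoothNear (d : ℕ) {G : Type*} [TopologicalSpace G] [ChartedSpace (Euc d) G]
    (χ : ℝ → BasedPath n b) (g : ℝ → G) (j : ℝ) : Prop :=
  j ∈ Ioo (0 : ℝ) 1 ∧ PiecewiseSmooth n (fun i : unitInterval => χ i 1) ∧
  ∃ V : Set ℝ, IsOpen V ∧ j ∈ V ∧
    SmoothFamilyOn n 𝓘(ℝ, ℝ) V (fun i => (χ i : unitInterval → M)) ∧
    ContMDiffOn 𝓘(ℝ, ℝ) (𝓡 d) ∞ g V

/-- The straight segment `T_{y,x}(i) = x + i(y - x)` in the coordinates `φ`. -/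
noncomputable def straightPath (φ : OpenPartialHomeomorph M (Euc n)) (y x : Euc n) :
    unitInterval → M := fun i => φ.symm (x + (i : ℝ) • (y - x))

end Holonomy

end LoopHolonomy

open LoopHolonomy

namespace LoopHolonomy

/-! ### Thin loops: images of loops in the line, relative homotopies, cancellation. -/

section ThinCalculus

variable {X M : Type*}

/-! Fix a = {p,g} and trivialize E near a by prolonging p with segments that are straight in the
chart at p(1). In this trivialization a curve {χ[i],γ(i)} has the components r(i) = χ[i](1) and
H(χ[i]⁻¹ ∘ segment ∘ p) γ(i). Horizontal vectors, however, come from transport along r itself, so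
the arc of r between j and i should stand in place of the segment. By `val_trans` the two
expressions differ by the left factor q(i) = H((arc ∘ p)⁻¹ ∘ (segment ∘ p)), with q(j) = e. The
crux, `hasMFDerivAt_val_arc_radialPath`, is that q'(j) = 0.

To see this, Hadamard's lemma gives r(j+s) = r(j) + s w(s) in the chart, with w smooth. The
two-parameter families of paths t ↦ r(j) + t a w(ts) and t ↦ r(j) + t a w(s) are the arc and the
segment when a = s, and they coincide when a = 0 or s = 0. By the smoothness axiom, the holonomy of
the loop formed by the two is a smooth function of (a,s). It equals e on both axes, so its
differential at the origin vanishes, in particular along the diagonal.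

Hence there is a linear isomorphism T onto the tangent space at a (`exists_frame`) such that the
velocity of {χ[i],γ(i)} is T(v,η), where v is the velocity of r and η that of H(χ[i]⁻¹ ∘ arc ∘ p)
γ(i). For a curve {K(r,i),h} the latter function is constant, because K(r,i) and arc ∘ K(r,j) differ
by retracing. As every v is the velocity of some based path, T identifies Γ_a with η = 0 and V_a
with v = 0 (`exists_frame_splitting`). The orbit map has the differential ξ ↦ T(0, gξ), so ω T(v,η)
= g⁻¹η (`connForm_eq_of_frame`).

The holonomy formula is the case p = χ[j], after the arc is exchanged for K(p,i) ∘ K(p,j)⁻¹, which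
again costs only a thin loop. The local coefficients are the case of a coordinate line, whose arcs
are straight segments in the coordinates. -/

theorem pcomp_map (p : X → M) (f g : unitInterval → X) : (p ∘ f) ⊙ (p ∘ g) = p ∘ (f ⊙ g) := by
  funext t
  simp only [pcomp, Function.comp_apply]
  split_ifs <;> rfl

theorem pinv_map (p : X → M) (f : unitInterval → X) : pinv (p ∘ f) = p ∘ pinv f := rfl

variable [TopologicalSpace X] [TopologicalSpace M]

theorem continuous_pcomp_family {α β : X → unitInterval → M}
    (hα : Continuous fun z : X × unitInterval => α z.1 z.2)
    (hβ : Continuous fun z : X × unitInterval => β z.1 z.2) (h : ∀ x, β x 1 = α x 0) :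
    Continuous fun z : X × unitInterval => (α z.1 ⊙ β z.1) z.2 := by
  refine Continuous.if_le (f := fun z : X × unitInterval => (z.2 : ℝ)) (g := fun _ => (1 / 2 : ℝ))
    (f' := fun z => IccExtend zero_le_one (β z.1) (2 * (z.2 : ℝ)))
    (g' := fun z => IccExtend zero_le_one (α z.1) (2 * (z.2 : ℝ) - 1)) ?_ ?_
    (by fun_prop) (by fun_prop) ?_
  · exact hβ.comp (f := fun z : X × unitInterval =>
      (z.1, projIcc (0 : ℝ) 1 zero_le_one (2 * (z.2 : ℝ))))
      (continuous_fst.prodMk (continuous_projIcc.comp (by fun_prop)))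
  · exact hα.comp (f := fun z : X × unitInterval =>
      (z.1, projIcc (0 : ℝ) 1 zero_le_one (2 * (z.2 : ℝ) - 1)))
      (continuous_fst.prodMk (continuous_projIcc.comp (by fun_prop)))
  · intro z hz
    have e1 : IccExtend zero_le_one (β z.1) (2 * (1 / 2 : ℝ)) = β z.1 1 := by norm_num
    have e2 : IccExtend zero_le_one (α z.1) (2 * (1 / 2 : ℝ) - 1) = α z.1 0 := by norm_num
    rw [hz, e1, e2, h]

theorem continuous_pcomp {α β : unitInterval → M} (hα : Continuous α) (hβ : Continuous β)
    (h : β 1 = α 0) : Continuous (α ⊙ β) :=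
  (continuous_pcomp_family (X := Unit) (α := fun _ => α) (β := fun _ => β)
    (hα.comp continuous_snd) (hβ.comp continuous_snd) fun _ => h).comp
      (f := fun t : unitInterval => ((), t)) (by fun_prop)

/-- The range of `f` is an interval, so the linear contraction of `f` to `f 0` never leaves it.
Composing with `p` therefore stays in the image of the loop, as thinness demands. -/
theorem isThin_map_loop {p : ℝ → M} (hp : Continuous p) {f : unitInterval → ℝ} (hf : Continuous f)
    (h : f 0 = f 1) : IsThin (p ∘ f) := by
  have hc : Convex ℝ (range f) := Real.convex_iff_isPreconnected.2 (isPreconnected_range hf)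
  refine ⟨fun z => p ((1 - (z.1 : ℝ)) • f z.2 + (z.1 : ℝ) • f 0), by fun_prop, fun t => by simp,
    fun t => by simp, fun s => ⟨?_, ?_⟩, ?_⟩
  · simp only [← add_smul]; simp
  · simp only [← h, ← add_smul]; simp
  · rintro _ ⟨z, rfl⟩
    obtain ⟨t, ht⟩ := hc ⟨z.2, rfl⟩ ⟨0, rfl⟩ (sub_nonneg.2 z.1.2.2) z.1.2.1 (by ring)
    exact ⟨t, by simp only [Function.comp_apply, ht]⟩

/-- Two paths that are homotopic relative to their end points inside the union of their images
differ by a thin loop. -/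
theorem isThin_pinv_pcomp_of_homotopy {γ₀ γ₁ : unitInterval → M}
    {h : unitInterval × unitInterval → M} (hh : Continuous h) (h0 : ∀ t, h (0, t) = γ₀ t)
    (h1 : ∀ t, h (1, t) = γ₁ t) (hs : ∀ s, h (s, 0) = γ₀ 0) (ht : ∀ s, h (s, 1) = γ₀ 1)
    (hR : range h ⊆ range γ₀ ∪ range γ₁) : IsThin (pinv γ₀ ⊙ γ₁) := by
  have c0 : Continuous γ₀ := by
    have : γ₀ = fun t => h (0, t) := funext fun t => (h0 t).symm
    rw [this]; fun_prop
  have c1 : Continuous γ₁ := by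
    have : γ₁ = fun t => h (1, t) := funext fun t => (h1 t).symm
    rw [this]; fun_prop
  have e0 : γ₁ 0 = γ₀ 0 := by rw [← h1, hs]
  have e1 : γ₁ 1 = γ₀ 1 := by rw [← h1, ht]
  let P := liftPath (R := range γ₀ ∪ range γ₁) γ₀ c0 (fun t => Or.inl ⟨t, rfl⟩)
  let Q := (liftPath (R := range γ₀ ∪ range γ₁) γ₁ c1 (fun t => Or.inr ⟨t, rfl⟩)).cast
    (x' := ⟨γ₀ 0, Or.inl ⟨0, rfl⟩⟩) (y' := ⟨γ₀ 1, Or.inl ⟨1, rfl⟩⟩)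
    (Subtype.ext e0.symm) (Subtype.ext e1.symm)
  have hPQ : P.Homotopic Q := by
    refine ⟨⟨⟨⟨fun z => ⟨h z, hR ⟨z, rfl⟩⟩, by fun_prop⟩, fun t => Subtype.ext (h0 t),
      fun t => Subtype.ext (h1 t)⟩, ?_⟩⟩
    rintro s t (rfl | ht')
    · exact Subtype.ext (hs s)
    · rw [mem_singleton_iff] at ht'
      subst ht'
      exact Subtype.ext (ht s)
  -- In the fundamental groupoid of the union of the two images the classes of `P` and `Q` agree, so
  -- the loop is trivial there.
  refine isThin_of_homotopic (Q.trans P.symm) ?_ (fun t => ?_) ?_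
  · rw [← Path.Homotopic.Quotient.eq]
    rw [← Path.Homotopic.Quotient.eq] at hPQ
    simp [← hPQ]
  · exact (congrFun (coe_trans Q P.symm) t).symm
  · rw [pcomp_range (by simp [e1]), pinv_range]

/-- The path `χ` need not factor through `p`, so the loop is not the image of a loop in ℝ. Instead
`f` is deformed linearly to `f'` while `χ` stays fixed. The two ranges share the point `f 0`, hence
their union is an interval that contains the deformation. -/
theorem isThin_map_pcomp {p : ℝ → M} (hp : Continuous p) {f f' : unitInterval → ℝ}
    (hf : Continuous f) (hf' : Continuous f') (h0 : f 0 = f' 0) (h1 : f 1 = f' 1)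
    {χ : unitInterval → M} (hχ : Continuous χ) (hχ1 : χ 1 = p (f 0)) :
    IsThin (pinv ((p ∘ f) ⊙ χ) ⊙ ((p ∘ f') ⊙ χ)) := by
  have hc : Convex ℝ (range f ∪ range f') := Real.convex_iff_isPreconnected.2
    ((isPreconnected_range hf).union (f 0) ⟨0, rfl⟩ ⟨0, h0.symm⟩ (isPreconnected_range hf'))
  let k : unitInterval → unitInterval → M :=
    fun s t => p ((1 - (s : ℝ)) • f t + (s : ℝ) • f' t)
  have hk0 : ∀ s, k s 0 = p (f 0) := fun s => by
    simp only [k, ← h0, ← add_smul]; simp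
  have hk1 : ∀ s, k s 1 = p (f 1) := fun s => by
    simp only [k, ← h1, ← add_smul]; simp
  have e0 : k 0 = p ∘ f := by funext t; simp [k]
  have e1 : k 1 = p ∘ f' := by funext t; simp [k]
  refine isThin_pinv_pcomp_of_homotopy (h := fun z => (k z.1 ⊙ χ) z.2) ?_ ?_ ?_ ?_ ?_ ?_
  · exact continuous_pcomp_family (α := k) (β := fun _ => χ) (by fun_prop) (by fun_prop)
      (fun s => by rw [hk0, hχ1])
  · intro t; simp only [e0]
  · intro t; simp only [e1]
  · intro s; simp
  · intro s; simp [hk1]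
  · rintro _ ⟨z, rfl⟩
    rw [pcomp_range (by simp [hχ1]), pcomp_range (by simp [hχ1, h0])]
    have hz : (k z.1 ⊙ χ) z.2 ∈ range (k z.1 ⊙ χ) := ⟨_, rfl⟩
    rw [pcomp_range (by rw [hk0, hχ1])] at hz
    rcases hz with ⟨t, ht⟩ | hz
    · have hmem : p ((1 - (z.1 : ℝ)) • f t + (z.1 : ℝ) • f' t) ∈ p '' (range f ∪ range f') :=
        ⟨_, hc (Or.inl ⟨t, rfl⟩) (Or.inr ⟨t, rfl⟩) (sub_nonneg.2 z.1.2.2) z.1.2.1 (by ring), rfl⟩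
      rw [image_union, ← range_comp, ← range_comp] at hmem
      change k z.1 t ∈ _ at hmem
      rw [ht] at hmem
      rcases hmem with hm | hm
      · exact Or.inl (Or.inl hm)
      · exact Or.inr (Or.inl hm)
    · exact Or.inl (Or.inr hz)

/-- Prolonging two paths by the same path does not change their difference up to a thin loop. -/
theorem isThin_prolong {p q s : unitInterval → M} (hp : Continuous p) (hq : Continuous q)
    (hs : Continuous s) (h0 : q 0 = p 0) (h1 : q 1 = p 1) (hs0 : s 0 = p 1) :
    IsThin (pinv (pinv q ⊙ p) ⊙ (pinv (s ⊙ q) ⊙ (s ⊙ p))) := by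
  let R := range p ∪ range q ∪ range s
  let P := liftPath (R := R) p hp (fun t => Or.inl (Or.inl ⟨t, rfl⟩))
  let Q := (liftPath (R := R) q hq (fun t => Or.inl (Or.inr ⟨t, rfl⟩))).cast
    (x' := ⟨p 0, Or.inl (Or.inl ⟨0, rfl⟩)⟩) (y' := ⟨p 1, Or.inl (Or.inl ⟨1, rfl⟩)⟩)
    (Subtype.ext h0.symm) (Subtype.ext h1.symm)
  let S := (liftPath (R := R) s hs (fun t => Or.inr ⟨t, rfl⟩)).cast
    (x' := ⟨p 1, Or.inl (Or.inl ⟨1, rfl⟩)⟩) (y' := ⟨s 1, Or.inr ⟨1, rfl⟩⟩)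
    (Subtype.ext hs0.symm) rfl
  refine isThin_of_homotopic (((P.trans S).trans (Q.trans S).symm).trans (P.trans Q.symm).symm)
    ?_ (fun t => ?_) ?_
  · rw [← Path.Homotopic.Quotient.eq]
    -- The middle factor `S` followed by its inverse cancels.
    have key : (Path.Homotopic.Quotient.mk ((P.trans S).trans (Q.trans S).symm)) =
        Path.Homotopic.Quotient.mk (P.trans Q.symm) := by
      rw [Path.trans_symm]
      simp only [Path.Homotopic.Quotient.mk_trans]
      rw [Path.Homotopic.Quotient.trans_assoc (Path.Homotopic.Quotient.mk P) _ _,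
        ← Path.Homotopic.Quotient.trans_assoc (Path.Homotopic.Quotient.mk S) _ _]
      simp
    rw [Path.Homotopic.Quotient.mk_trans, key]
    simp only [Path.Homotopic.Quotient.mk_symm, Path.Homotopic.Quotient.mk_refl,
      Path.Homotopic.Quotient.trans_symm]
  · have e1 := coe_trans P S
    have e2 := coe_trans Q S
    have e3 := coe_trans P Q.symm
    have e4 := coe_trans (P.trans S) (Q.trans S).symm
    have e5 : (fun t => (((Q.trans S).symm t : R) : M)) =
      pinv (fun t => ((Q.trans S t : R) : M)) := rfl
    rw [e5, e1, e2] at e4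
    have e6 := coe_trans ((P.trans S).trans (Q.trans S).symm) (P.trans Q.symm).symm
    have e7 : (fun t => (((P.trans Q.symm).symm t : R) : M)) =
      pinv (fun t => ((P.trans Q.symm t : R) : M)) := rfl
    rw [e7, e3, e4] at e6
    exact (congrFun e6 t).symm
  · rw [pcomp_range (by simp), pinv_range, pcomp_range (by simp [h1]), pcomp_range (by simp),
      pinv_range, pinv_range, pcomp_range hs0.symm, pcomp_range (h1.trans hs0.symm)]
    intro x hx
    simp only [R, mem_union] at hx ⊢
    tauto

end ThinCalculus

/-! ### Hadamard's lemma with smooth quotient. -/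

section Hadamard

open MeasureTheory intervalIntegral

variable {E : Type*} [NormedAddCommGroup E] [NormedSpace ℝ E]

/-- Each differentiation under the integral sign produces one more factor `t`. Allowing an arbitrary
power makes the statement reproduce itself, so that it can be iterated. -/
theorem hasDerivAt_integral_pow_smul_comp_mul {f : ℝ → E} (hf : ContDiff ℝ 1 f) (k : ℕ) (s : ℝ) :
    HasDerivAt (fun s => ∫ t in (0 : ℝ)..1, t ^ k • f (t * s))
      (∫ t in (0 : ℝ)..1, t ^ (k + 1) • deriv f (t * s)) s := by
  have hc := hf.continuous
  have hd : Continuous (deriv f) := hf.continuous_deriv le_rfl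
  -- For `x` within distance 1 of `s` and `t` in (0,1], the point `t * x` lies in this interval, so
  -- `C` dominates the differentiated integrand.
  obtain ⟨C, hC⟩ := (isCompact_Icc (a := -(|s| + 1)) (b := |s| + 1)).exists_bound_of_continuousOn
    hd.continuousOn
  refine (hasDerivAt_integral_of_dominated_loc_of_deriv_le (bound := fun _ => C)
    (F' := fun x t => t ^ (k + 1) • deriv f (t * x)) (Metric.ball_mem_nhds s one_pos)
    (Eventually.of_forall fun x => ?_) ?_ ?_ (Eventually.of_forall fun t ht x hx => ?_) ?_
    (Eventually.of_forall fun t ht x hx => ?_)).2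
  · exact (by fun_prop : Continuous fun t => t ^ k • f (t * x)).aestronglyMeasurable
  · exact (by fun_prop : Continuous fun t => t ^ k • f (t * s)).intervalIntegrable _ _
  · exact (by fun_prop : Continuous fun t => t ^ (k + 1) • deriv f (t * s)).aestronglyMeasurable
  · rw [uIoc_of_le zero_le_one] at ht
    have hx' : |x| ≤ |s| + 1 := by
      have h1 : |x - s| < 1 := by simpa [Real.dist_eq] using hx
      linarith [abs_sub_abs_le_abs_sub x s]
    have hm : |t * x| ≤ |s| + 1 := by
      rw [abs_mul, abs_of_pos ht.1]
      nlinarith [ht.2, abs_nonneg x, ht.1]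
    have h2 := hC (t * x) ⟨(abs_le.1 hm).1, (abs_le.1 hm).2⟩
    rw [norm_smul, norm_pow, Real.norm_of_nonneg ht.1.le]
    calc t ^ (k + 1) * ‖deriv f (t * x)‖ ≤ 1 * ‖deriv f (t * x)‖ := by
          gcongr; exact pow_le_one₀ ht.1.le ht.2
      _ ≤ C := by rwa [one_mul]
  · exact continuous_const.intervalIntegrable _ _
  · have h1 : HasDerivAt f (deriv f (t * x)) (t * x) :=
      (hf.differentiable one_ne_zero _).hasDerivAt
    have h2 : HasDerivAt (fun x => t * x) t x := by simpa using (hasDerivAt_id x).const_mul t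
    have h3 := (h1.scomp x h2).const_smul (t ^ k)
    rw [smul_smul, ← pow_succ] at h3
    exact h3

theorem contDiff_integral_pow_smul_comp_mul (m : ℕ) {f : ℝ → E} (hf : ContDiff ℝ ∞ f) (k : ℕ) :
    ContDiff ℝ m (fun s => ∫ t in (0 : ℝ)..1, t ^ k • f (t * s)) := by
  have hd := fun (f : ℝ → E) (hf : ContDiff ℝ ∞ f) (k : ℕ) (s : ℝ) =>
    hasDerivAt_integral_pow_smul_comp_mul (hf.of_le (by exact_mod_cast le_top)) k s
  induction m generalizing f k with
  | zero =>
    rw [Nat.cast_zero, contDiff_zero]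
    exact continuous_iff_continuousAt.2 fun s => (hd f hf k s).continuousAt
  | succ m ih =>
    rw [Nat.cast_succ, contDiff_succ_iff_deriv]
    refine ⟨fun s => (hd f hf k s).differentiableAt, by simp, ?_⟩
    rw [funext fun s => (hd f hf k s).deriv]
    exact ih (contDiff_infty_iff_deriv.1 hf).2 _

/-- Hadamard's lemma for curves: a smooth curve that vanishes at `0` is divisible by the
parameter. -/
theorem exists_contDiff_smul_eq [CompleteSpace E] {f : ℝ → E} (hf : ContDiff ℝ ∞ f)
    (h0 : f 0 = 0) : ∃ w : ℝ → E, ContDiff ℝ ∞ w ∧ ∀ s, f s = s • w s := by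
  have hdf : ContDiff ℝ ∞ (deriv f) := (contDiff_infty_iff_deriv.1 hf).2
  -- The quotient is the mean of `f'` over the segment from 0 to `s`. Integrating the derivative of
  -- `t ↦ f (t * s)` gives `f s - f 0`.
  refine ⟨fun s => ∫ t in (0 : ℝ)..1, t ^ 0 • deriv f (t * s),
    contDiff_infty.2 fun m => contDiff_integral_pow_smul_comp_mul m hdf 0, fun s => ?_⟩
  have h1 : ∀ t : ℝ, HasDerivAt (fun t => f (t * s)) (s • deriv f (t * s)) t := fun t => by
    have h2 : HasDerivAt (fun t => t * s) s t := by simpa using (hasDerivAt_id t).mul_const s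
    exact (hf.differentiable (by simp) _).hasDerivAt.scomp t h2
  have hc : Continuous (deriv f) := hdf.continuous
  have := integral_eq_sub_of_hasDerivAt (a := 0) (b := 1) (fun t _ => h1 t)
    ((by fun_prop : Continuous fun t => s • deriv f (t * s)).intervalIntegrable _ _)
  simp only [pow_zero, one_smul]
  rw [← intervalIntegral.integral_smul, this]
  simp [h0]

/-- Multiplying by a bump function gives a globally smooth curve with the same germ at 0, to which
the global version applies. -/
theorem exists_contDiff_eventually_smul_eq [CompleteSpace E] {f : ℝ → E}
    {V : Set ℝ} (hV : V ∈ 𝓝 (0 : ℝ)) (hf : ContDiffOn ℝ ∞ f V) (h0 : f 0 = 0) :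
    ∃ w : ℝ → E, ContDiff ℝ ∞ w ∧ ∀ᶠ s in 𝓝 0, f s = s • w s := by
  obtain ⟨g, hg1, hg2, hg3⟩ :
      ∃ g : ℝ → E, ContDiff ℝ ∞ g ∧ g =ᶠ[𝓝 0] f ∧ g 0 = 0 := by
    obtain ⟨ε, hε, hball⟩ := Metric.mem_nhds_iff.1 hV
    let B : ContDiffBump (0 : ℝ) := ⟨ε / 4, ε / 2, by positivity, by linarith⟩
    have heq : (fun s => B s • f s) =ᶠ[𝓝 0] f := by
      filter_upwards [B.eventuallyEq_one] with s hs
      simp [hs]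
    refine ⟨fun s => B s • f s, contDiff_iff_contDiffAt.2 fun s => ?_, heq, by simp [h0]⟩
    by_cases hs : s ∈ Metric.ball (0 : ℝ) ε
    · exact B.contDiff.contDiffAt.smul
        ((hf.mono hball).contDiffAt (Metric.isOpen_ball.mem_nhds hs))
    · have : (fun s => B s • f s) =ᶠ[𝓝 s] fun _ => 0 := by
        have ht : s ∉ tsupport B := by
          rw [B.tsupport_eq]
          intro hs'
          exact hs (Metric.closedBall_subset_ball (by simp [B]; linarith) hs')
        filter_upwards [(isClosed_tsupport (B : ℝ → ℝ)).isOpen_compl.mem_nhds ht] with x hx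
        simp [image_eq_zero_of_notMem_tsupport hx]
      exact contDiffAt_const.congr_of_eventuallyEq this
  obtain ⟨w, hw, h⟩ := exists_contDiff_smul_eq hg1 hg3
  exact ⟨w, hw, hg2.mono fun s hs => by rw [← hs, h]⟩

end Hadamard

/-! ### Arcs of a curve compared with the contractions K(p,i). -/

section Arcs

variable {M : Type*}

/-- The part of a curve between the parameters `j` and `i`, as a path on `[0,1]`. -/
def arc (p : ℝ → M) (j i : ℝ) : unitInterval → M := fun t => p (j + (t : ℝ) * (i - j))

@[simp] theorem arc_zero (p : ℝ → M) (j i : ℝ) : arc p j i 0 = p j := by simp [arc]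

@[simp] theorem arc_one (p : ℝ → M) (j i : ℝ) : arc p j i 1 = p i := by simp [arc]

theorem arc_self (p : ℝ → M) (j : ℝ) : arc p j j = fun _ => p j := by
  funext t; simp [arc]

theorem contr_eq (p : unitInterval → M) (i : unitInterval) :
    contr p i = IccExtend zero_le_one p ∘ fun t : unitInterval => (i : ℝ) * t := by
  funext t
  change _ = IccExtend zero_le_one p ((i * t : unitInterval) : ℝ)
  rw [IccExtend_val]
  rfl

variable [TopologicalSpace M]

/-- All three pieces are images under the extended `p` of paths in ℝ, which run 0 → j → i → 0. This
is why arcs are taken of `IccExtend p`. -/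
theorem isThin_contr_arc {p : unitInterval → M} (hp : Continuous p) (i j : unitInterval) :
    IsThin (pinv (contr p i) ⊙ (arc (IccExtend zero_le_one p) j i ⊙ contr p j)) := by
  have h : arc (IccExtend zero_le_one p) j i =
      IccExtend zero_le_one p ∘ fun t : unitInterval => (j : ℝ) + t * (i - j) := rfl
  rw [contr_eq, contr_eq, h, pinv_map, pcomp_map, pcomp_map]
  refine isThin_map_loop hp.Icc_extend' (continuous_pcomp ?_ (continuous_pcomp ?_ ?_ ?_) ?_) ?_
  · exact (by fun_prop : Continuous fun t : unitInterval => (i : ℝ) * t).comp (by fun_prop)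
  · fun_prop
  · fun_prop
  · simp
  · simp
  · simp

/-- Both continuations of `χ` are images under `p` of paths in ℝ from `j` to `i`: one direct, the
other through 0. -/
theorem isThin_arc_contr {p : unitInterval → M} (hp : Continuous p) (i j : unitInterval)
    {χ : unitInterval → M} (hχ : Continuous χ) (h : χ 1 = p j) :
    IsThin (pinv (arc (IccExtend zero_le_one p) j i ⊙ χ) ⊙ ((contr p i ⊙ pinv (contr p j)) ⊙ χ)) := by
  have e : arc (IccExtend zero_le_one p) j i =
      IccExtend zero_le_one p ∘ fun t : unitInterval => (j : ℝ) + t * (i - j) := rfl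
  rw [contr_eq, contr_eq, e, pinv_map, pcomp_map]
  refine isThin_map_pcomp hp.Icc_extend' (by fun_prop) (continuous_pcomp ?_ ?_ ?_) ?_ ?_ hχ ?_
  · fun_prop
  · exact (by fun_prop : Continuous fun t : unitInterval => (j : ℝ) * t).comp (by fun_prop)
  · simp
  · simp
  · simp
  · simp [h]

/-- Waiting at the end point and then retracing is the image under `p` of a loop in ℝ. The lemma
removes the constant path that appears whenever an arc or a segment degenerates. -/
theorem isThin_const_pcomp {p : unitInterval → M} (hp : Continuous p) :
    IsThin (pinv p ⊙ ((fun _ => p 1) ⊙ p)) := by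
  have e1 : p = IccExtend zero_le_one p ∘ ((↑) : unitInterval → ℝ) := by
    funext t; simp
  have e2 : (fun _ : unitInterval => p 1) = IccExtend zero_le_one p ∘ fun _ => (1 : ℝ) := by
    funext t; simp
  have e3 : IsThin (pinv (IccExtend zero_le_one p ∘ ((↑) : unitInterval → ℝ)) ⊙
      ((IccExtend zero_le_one p ∘ fun _ => (1 : ℝ)) ⊙
        (IccExtend zero_le_one p ∘ ((↑) : unitInterval → ℝ)))) := by
    rw [pinv_map, pcomp_map, pcomp_map]
    refine isThin_map_loop hp.Icc_extend' (continuous_pcomp ?_ (continuous_pcomp ?_ ?_ ?_) ?_) ?_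
    · exact continuous_subtype_val.comp (by fun_prop)
    · fun_prop
    · fun_prop
    · simp
    · simp
    · simp
  rwa [← e1, ← e2] at e3

end Arcs

/-! ### Criteria for smooth families of paths. -/

section SmoothFamilies

variable {n : ℕ} {M : Type*} [TopologicalSpace M] [ChartedSpace (Euc n) M]
    {F : Type*} [NormedAddCommGroup F] [NormedSpace ℝ F] {H' : Type*}
    [TopologicalSpace H'] {J : ModelWithCorners ℝ F H'} {N : Type*} [TopologicalSpace N]
    [ChartedSpace H' N]

/-- Only the model with corners differs: families carry the product model on `F × F₂`, while
ordinary smoothness uses the model of the product space. -/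
theorem contMDiff_of_contDiff_prod {F₂ E : Type*} [NormedAddCommGroup F₂] [NormedSpace ℝ F₂]
    [NormedAddCommGroup E] [NormedSpace ℝ E] {f : F × F₂ → E} (hf : ContDiff ℝ ∞ f) :
    ContMDiff (𝓘(ℝ, F).prod 𝓘(ℝ, F₂)) 𝓘(ℝ, E) ∞ f := by
  rw [← modelWithCornersSelf_prod, chartedSpaceSelf_prod]
  exact hf.contMDiff

theorem smoothFamilyOn_of_contMDiffOn {U : Set N} {f : N × ℝ → M}
    (hf : ContMDiffOn (J.prod 𝓘(ℝ, ℝ)) (𝓡 n) ∞ f (U ×ˢ Icc (0 : ℝ) 1)) :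
    SmoothFamilyOn n J U (fun u t => f (u, t)) := by
  refine ⟨?_, ∅, fun a c h0 _ h1 _ => ?_⟩
  · exact hf.continuousOn.comp (f := fun z : N × unitInterval => (z.1, (z.2 : ℝ)))
      (by fun_prop) (fun z hz => ⟨hz.1, z.2.2⟩)
  · refine (hf.mono (prod_mono Subset.rfl (Icc_subset_Icc h0 h1))).congr fun z hz => ?_
    rw [IccExtend_of_mem _ _ ⟨h0.trans hz.2.1, hz.2.2.trans h1⟩]

/-- Convexity of `V` keeps every parameter between `j` and `i` inside the domain of smoothness. -/
theorem smoothFamilyOn_arc {r : ℝ → M} {V : Set ℝ} (hV : Convex ℝ V) {j : ℝ} (hj : j ∈ V)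
    (hr : ContMDiffOn 𝓘(ℝ, ℝ) (𝓡 n) ∞ r V) :
    SmoothFamilyOn n 𝓘(ℝ, ℝ) V (fun i => arc r j i) := by
  refine smoothFamilyOn_of_contMDiffOn (f := fun z : ℝ × ℝ => r (j + z.2 * (z.1 - j))) ?_
  refine hr.comp (f := fun z : ℝ × ℝ => j + z.2 * (z.1 - j)) ?_ fun z hz => ?_
  · exact (contMDiff_of_contDiff_prod
      (by fun_prop : ContDiff ℝ ∞ fun z : ℝ × ℝ => j + z.2 * (z.1 - j))).contMDiffOn
  · have := hV hj hz.1 (sub_nonneg.2 hz.2.2) hz.2.1 (by ring)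
    simp only [smul_eq_mul] at this
    change j + z.2 * (z.1 - j) ∈ V
    convert this using 1
    ring

/-- Families of end points of smooth families are smooth. -/
theorem SmoothFamilyOn.contMDiffOn_one {U : Set N} {ψ : N → unitInterval → M}
    (h : SmoothFamilyOn n J U ψ) : ContMDiffOn J (𝓡 n) ∞ (fun u => ψ u 1) U := by
  obtain ⟨-, S, hS⟩ := h
  -- The degenerate interval [1,1] has empty interior, so it avoids every set of break points.
  have := (hS 1 1 zero_le_one le_rfl le_rfl (by simp)).comp (f := fun u : N => (u, (1 : ℝ)))
    (contMDiff_id.prodMk contMDiff_const).contMDiffOn (fun u hu => ⟨hu, by simp⟩)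
  refine this.congr fun u _ => ?_
  simp

end SmoothFamilies

/-- A function of two variables that is constant on the coordinate axes has vanishing differential
along the diagonal. -/
theorem hasMFDerivAt_diag_of_const_axes {d : ℕ} {G : Type*} [TopologicalSpace G]
    [ChartedSpace (Euc d) G] {Q : ℝ × ℝ → G} {g : G}
    (hQ : MDifferentiableAt 𝓘(ℝ, ℝ × ℝ) (𝓡 d) Q (0, 0))
    (h1 : ∀ᶠ s in 𝓝 (0 : ℝ), Q (s, 0) = g) (h2 : ∀ᶠ s in 𝓝 (0 : ℝ), Q (0, s) = g) :
    HasMFDerivAt 𝓘(ℝ, ℝ) (𝓡 d) (fun s : ℝ => Q (s, s)) 0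
      (0 : ℝ →L[ℝ] EuclideanSpace ℝ (Fin d)) := by
  obtain ⟨D, hD⟩ : ∃ D : (ℝ × ℝ) →L[ℝ] EuclideanSpace ℝ (Fin d),
      HasMFDerivAt 𝓘(ℝ, ℝ × ℝ) (𝓡 d) Q (0, 0) D := ⟨_, hQ.hasMFDerivAt⟩
  -- Along any line through the origin the derivative is `D` composed with that line. The two axes
  -- force `D = 0`, and the diagonal is a third line.
  have key : ∀ L : ℝ →L[ℝ] ℝ × ℝ, HasMFDerivAt 𝓘(ℝ, ℝ) (𝓡 d) (fun s : ℝ => Q (L s)) 0 (D.comp L) := by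
    intro L
    have hL : HasMFDerivAt 𝓘(ℝ, ℝ) 𝓘(ℝ, ℝ × ℝ) L 0 L := L.hasFDerivAt.hasMFDerivAt
    have hD' : HasMFDerivAt 𝓘(ℝ, ℝ × ℝ) (𝓡 d) Q (L 0) D := by
      rw [map_zero]; exact hD
    exact hD'.comp (0 : ℝ) hL
  have e1 : D.comp (ContinuousLinearMap.inl ℝ ℝ ℝ) = 0 :=
    hasMFDerivAt_unique (key (ContinuousLinearMap.inl ℝ ℝ ℝ))
      ((hasMFDerivAt_const g (0 : ℝ)).congr_of_eventuallyEq (h1.mono fun s hs => hs))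
  have e2 : D.comp (ContinuousLinearMap.inr ℝ ℝ ℝ) = 0 :=
    hasMFDerivAt_unique (key (ContinuousLinearMap.inr ℝ ℝ ℝ))
      ((hasMFDerivAt_const g (0 : ℝ)).congr_of_eventuallyEq (h2.mono fun s hs => hs))
  have e3 : D = 0 := by
    ext1
    · exact e1
    · exact e2
  exact (key ((ContinuousLinearMap.id ℝ ℝ).prod (ContinuousLinearMap.id ℝ ℝ))).congr_mfderiv
    (by rw [e3]; exact ContinuousLinearMap.zero_comp _)

/-! ### Values of H on differences of paths. -/

section Values

variable {n d : ℕ} {M : Type*} [TopologicalSpace M] [ChartedSpace (Euc n) M] {b : M}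
  {G : Type*} [Group G] [TopologicalSpace G] [ChartedSpace (Euc d) G]

/-- The prolongation of a path of `PM` by a path that starts at its end point. -/
noncomputable def BasedPath.prolong (p : BasedPath n b) (s : unitInterval → M)
    (hs : PiecewiseSmooth n s) (h : p 1 = s 0) : BasedPath n b where
  toFun := s ⊙ p
  smooth := hs.pcomp p.smooth h
  source := by simpa using p.source

namespace HolonomyMap

variable (H : HolonomyMap n d b G)

theorem val_congr_right (p : BasedPath n b) {q r : BasedPath n b} (hq : q 1 = p 1) (hr : r 1 = p 1)
    (h : IsThin (pinv q ⊙ r)) : H.val (pinv p ⊙ r) = H.val (pinv p ⊙ q) := by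
  rw [← H.val_trans hq hr, H.val_thin h, one_mul]

theorem val_congr_left (p : BasedPath n b) {q r : BasedPath n b} (hq : q 1 = p 1) (hr : r 1 = p 1)
    (h : IsThin (pinv q ⊙ r)) : H.val (pinv r ⊙ p) = H.val (pinv q ⊙ p) := by
  rw [← H.val_trans (hr.trans hq.symm) hq.symm, H.val_thin h, mul_one]

/-- Both sides become inverse to the same group element: composing either loop with the reverse of
`q⁻¹ ∘ p` gives a thin loop, so that element can be cancelled. -/
theorem val_prolong {p q : BasedPath n b} (h : q 1 = p 1) {s : unitInterval → M}
    (hs : PiecewiseSmooth n s) (hs0 : s 0 = p 1) :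
    H.val (pinv (s ⊙ q) ⊙ (s ⊙ p)) = H.val (pinv q ⊙ p) := by
  have hp0 := p.source
  have hq0 := q.source
  have hA : PiecewiseSmooth n (pinv (s ⊙ q) ⊙ (s ⊙ p)) :=
    smooth_diff (p := q.prolong s hs (h.trans hs0.symm)) (q := p.prolong s hs hs0.symm)
      (by simp [BasedPath.prolong])
  have hB : PiecewiseSmooth n (pinv q ⊙ p) := smooth_diff h.symm
  have h1 := H.val_thin (isThin_prolong p.smooth.1 q.smooth.1 hs.1 (hq0.trans hp0.symm) h hs0)
  have h2 := H.val_thin (isThin_pinv_pcomp hB.1)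
  rw [H.val_pcomp hB.pinv (by simp [hq0]) (by simp [hp0]) hA (by simp [hp0]) (by simp [hq0])] at h1
  rw [H.val_pcomp hB.pinv (by simp [hq0]) (by simp [hp0]) hB (by simp [hp0]) (by simp [hq0])] at h2
  exact mul_right_cancel (h1.trans h2.symm)

/-- Up to a thin loop K(r,i) is the arc after K(r,j), and a common last piece drops out of a
difference of paths. So the value does not depend on `i`, which is what makes the curves {K(r,i),h}
horizontal. -/
theorem val_contr_arc {p r : BasedPath n b} {i j : unitInterval} (hp : p 1 = r j)
    (harc : PiecewiseSmooth n (arc (IccExtend zero_le_one (r : unitInterval → M)) j i)) :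
    H.val (pinv (r.contr i) ⊙ (arc (IccExtend zero_le_one (r : unitInterval → M)) j i ⊙ p)) =
      H.val (pinv (r.contr j) ⊙ p) := by
  have e : (r.contr j) 1 = p 1 := by simp [BasedPath.contr, LoopHolonomy.contr, hp]
  have h1 := H.val_congr_left (p.prolong _ harc (by simp [hp]))
    (q := r.contr i) (r := (r.contr j).prolong _ harc (by simp [e, hp]))
    (by simp [BasedPath.prolong, BasedPath.contr, LoopHolonomy.contr])
    (by simp [BasedPath.prolong]) (isThin_contr_arc r.smooth.1 i j)
  have h2 := H.val_prolong e harc (by simp [hp])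
  exact h1.symm.trans h2

theorem val_pinv_arc_self (p : BasedPath n b) {r : ℝ → M} {j : ℝ} (hj : r j = p 1) :
    H.val (pinv p ⊙ (arc r j j ⊙ p)) = 1 := by
  rw [arc_self, hj]
  exact H.val_thin (isThin_const_pcomp p.smooth.1)

variable {F : Type*} [NormedAddCommGroup F] [NormedSpace ℝ F] [FiniteDimensional ℝ F]

/-- The smoothness axiom speaks of Euclidean parameter spaces. A linear isomorphism carries it to
any finite-dimensional one, such as ℝ or ℝ × ℝ with its product norm. -/
theorem contMDiffOn_val_space {U : Set F} (hU : IsOpen U) {w : F → unitInterval → M}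
    (hw : SmoothFamilyOn n 𝓘(ℝ, F) U w) (h0 : ∀ u ∈ U, w u 0 = b) (h1 : ∀ u ∈ U, w u 1 = b) :
    ContMDiffOn 𝓘(ℝ, F) (𝓡 d) ∞ (fun u => H.val (w u)) U := by
  classical
  let e : F ≃L[ℝ] Euc (Module.finrank ℝ F) := toEuclidean
  have hV : IsOpen (e.symm ⁻¹' U) := hU.preimage e.symm.continuous
  have hfam : SmoothFamilyOn n (𝓡 (Module.finrank ℝ F)) (e.symm ⁻¹' U) (fun v => w (e.symm v)) :=
    hw.comp e.symm.contDiff.contMDiff.contMDiffOn (fun v hv => hv)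
  let Ω : Euc (Module.finrank ℝ F) → BasedLoop n b := fun v =>
    if hv : v ∈ e.symm ⁻¹' U then
      ⟨⟨w (e.symm v), hfam.piecewiseSmooth hv, h0 _ hv⟩, h1 _ hv⟩
    else ⟨constPath n b, rfl⟩
  have hΩ : ∀ v ∈ e.symm ⁻¹' U, (Ω v : unitInterval → M) = w (e.symm v) := fun v hv => by
    simp only [Ω, dif_pos hv]
  have key := H.smooth _ _ hV Ω (hfam.congr hΩ)
  have key2 : ContMDiffOn (𝓡 (Module.finrank ℝ F)) (𝓡 d) ∞ (fun v => H.val (w (e.symm v)))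
      (e.symm ⁻¹' U) := by
    refine key.congr (fun v hv => ?_)
    rw [H.val_eq (hfam.piecewiseSmooth hv) (h0 _ hv) (h1 _ hv)]
    simp only [Ω, dif_pos hv]
  refine (key2.comp (f := e) e.contDiff.contMDiff.contMDiffOn (fun u hu => ?_)).congr
    (fun u hu => ?_)
  · simpa using hu
  · simp

end HolonomyMap

end Values

/-! ### First-order agreement of transport along arcs and along chart segments. -/

section KeyLemma

variable {n d : ℕ} {M : Type*} [TopologicalSpace M] [ChartedSpace (Euc n) M]
  {b : M} {G : Type*} [Group G] [TopologicalSpace G] [ChartedSpace (Euc d) G]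

/-- The path from `x` to `u` that is straight in the chart at `x`. -/
noncomputable def radialPath (x u : M) : unitInterval → M := fun t =>
  (chartAt (Euc n) x).symm (chartAt (Euc n) x x + (t : ℝ) • (chartAt (Euc n) x u - chartAt (Euc n) x x))

theorem radialPath_self (x : M) : radialPath (n := n) x x = fun _ => x := by
  funext t; simp [radialPath]

variable [IsManifold (𝓡 n) ∞ M]

namespace HolonomyMap

variable (H : HolonomyMap n d b G)

/-- Parallel transport along a curve and along the straight segments to its points agree to first
order. -/
theorem hasMFDerivAt_val_arc_radialPath (p : BasedPath n b) {r : ℝ → M} {j : ℝ} {V : Set ℝ}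
    (hV : V ∈ 𝓝 j) (hr : ContMDiffOn 𝓘(ℝ, ℝ) (𝓡 n) ∞ r V) (hj : r j = p 1) :
    HasMFDerivAt 𝓘(ℝ, ℝ) (𝓡 d)
      (fun i => H.val (pinv (arc r j i ⊙ p) ⊙ (radialPath (n := n) (p 1) (r i) ⊙ p))) j
      (0 : ℝ →L[ℝ] EuclideanSpace ℝ (Fin d)) := by
  set x := p 1 with hx
  let c := chartAt (Euc n) x
  have hcs : ContMDiffOn (𝓡 n) (𝓡 n) ∞ c c.source := contMDiffOn_chart
  have hct : ContMDiffOn (𝓡 n) (𝓡 n) ∞ c.symm c.target := contMDiffOn_chart_symm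
  obtain ⟨ε, hε, hball⟩ := Metric.isOpen_iff.1 c.open_target (c x) (mem_chart_target _ x)
  have hrc : ContinuousAt r j := (hr.contMDiffAt hV).continuousAt
  obtain ⟨δ, hδ, hδV⟩ : ∃ δ > 0, Metric.ball j δ ⊆ V ∩ r ⁻¹' c.source := by
    refine Metric.mem_nhds_iff.1 (inter_mem hV (hrc.preimage_mem_nhds ?_))
    rw [hj]
    exact c.open_source.mem_nhds (mem_chart_source _ x)
  let ρ : ℝ → Euc n := fun s => c (r (j + s)) - c x
  have hmem : ∀ s ∈ Metric.ball (0 : ℝ) δ, j + s ∈ Metric.ball j δ := fun s hs => by simpa using hs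
  have hρ : ContDiffOn ℝ ∞ ρ (Metric.ball 0 δ) := by
    rw [← contMDiffOn_iff_contDiffOn]
    refine ContMDiffOn.sub ?_ contMDiffOn_const
    refine hcs.comp (hr.comp (f := fun s => j + s) ?_ fun s hs => (hδV (hmem s hs)).1)
      fun s hs => (hδV (hmem s hs)).2
    exact (by fun_prop : ContDiff ℝ ∞ fun s : ℝ => j + s).contMDiff.contMDiffOn
  -- In the chart the curve is now `c x + s • w s`. The factor `s` and the argument of `w` will be
  -- varied independently.
  obtain ⟨w, hw, hρw⟩ := exists_contDiff_eventually_smul_eq (Metric.ball_mem_nhds 0 hδ) hρ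
    (by simp [ρ, hj])
  obtain ⟨C, hC⟩ := (isCompact_Icc (a := (-1 : ℝ)) (b := 1)).exists_bound_of_continuousOn
    hw.continuous.continuousOn
  have hC0 : 0 ≤ C := (norm_nonneg _).trans (hC 0 (by simp))
  -- As `C` bounds `w` on [-1,1], this makes |z.1| ‖w‖ < ε, so all paths stay in the chart. The
  -- summand 1 avoids division by zero.
  let η : ℝ := ε / (C + 1)
  have hη : 0 < η := by positivity
  let W : Set (ℝ × ℝ) := Metric.ball 0 η ×ˢ Metric.ball 0 1
  have hW : IsOpen W := Metric.isOpen_ball.prod Metric.isOpen_ball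
  have hW0 : ((0 : ℝ), (0 : ℝ)) ∈ W := ⟨Metric.mem_ball_self hη, Metric.mem_ball_self one_pos⟩
  have hin : ∀ z ∈ W, ∀ t ∈ Icc (0 : ℝ) 1, ∀ u ∈ Icc (0 : ℝ) 1,
      c x + (t * z.1) • w (u * z.2) ∈ c.target := by
    intro z hz t ht u hu
    refine hball ?_
    have h1 : |z.1| < η := by simpa using hz.1
    have h2 : |z.2| < 1 := by simpa using hz.2
    have h3 : |u * z.2| ≤ 1 := by
      rw [abs_mul, abs_of_nonneg hu.1]
      nlinarith [hu.2, hu.1, abs_nonneg z.2]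
    have h4 := hC (u * z.2) (abs_le.1 h3)
    have h5 : |t * z.1| < η := by
      rw [abs_mul, abs_of_nonneg ht.1]
      nlinarith [ht.2, ht.1, abs_nonneg z.1]
    rw [Metric.mem_ball, dist_self_add_left, norm_smul, Real.norm_eq_abs]
    calc |t * z.1| * ‖w (u * z.2)‖ ≤ |t * z.1| * C := by gcongr
      _ ≤ η * C := by gcongr
      _ < η * (C + 1) := by nlinarith
      _ = ε := by simp only [η]; field_simp
  -- On the diagonal `A` is the arc and `B` the straight segment. They agree as soon as one
  -- coordinate of `z` vanishes. The factor `1 *` in `B` lets `hin` serve both families, with `u =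
  -- t` and `u = 1`.
  let A : ℝ × ℝ → unitInterval → M := fun z t => c.symm (c x + ((t : ℝ) * z.1) • w (t * z.2))
  let B : ℝ × ℝ → unitInterval → M := fun z t => c.symm (c x + ((t : ℝ) * z.1) • w (1 * z.2))
  have hA : SmoothFamilyOn n 𝓘(ℝ, ℝ × ℝ) W A := by
    refine smoothFamilyOn_of_contMDiffOn
      (f := fun z : (ℝ × ℝ) × ℝ => c.symm (c x + (z.2 * z.1.1) • w (z.2 * z.1.2))) ?_
    exact hct.comp (contMDiff_of_contDiff_prod (by fun_prop : ContDiff ℝ ∞ fun z : (ℝ × ℝ) × ℝ =>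
      c x + (z.2 * z.1.1) • w (z.2 * z.1.2))).contMDiffOn
      fun z hz => hin z.1 hz.1 _ hz.2 _ hz.2
  have hB : SmoothFamilyOn n 𝓘(ℝ, ℝ × ℝ) W B := by
    refine smoothFamilyOn_of_contMDiffOn
      (f := fun z : (ℝ × ℝ) × ℝ => c.symm (c x + (z.2 * z.1.1) • w (1 * z.1.2))) ?_
    exact hct.comp (contMDiff_of_contDiff_prod (by fun_prop : ContDiff ℝ ∞ fun z : (ℝ × ℝ) × ℝ =>
      c x + (z.2 * z.1.1) • w (1 * z.1.2))).contMDiffOn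
      fun z hz => hin z.1 hz.1 _ hz.2 _ (by simp)
  have hcx : c.symm (c x) = x := c.left_inv (mem_chart_source _ x)
  have hA0 : ∀ z, A z 0 = x := fun z => by simp [A, hcx]
  have hB0 : ∀ z, B z 0 = x := fun z => by simp [B, hcx]
  have hAp := hA.pcomp (SmoothFamilyOn.const p.smooth W) fun z _ => (hA0 z).symm
  have hBp := hB.pcomp (SmoothFamilyOn.const p.smooth W) fun z _ => (hB0 z).symm
  let Q : ℝ × ℝ → G := fun z => H.val (pinv (A z ⊙ p) ⊙ (B z ⊙ p))
  have hQ : ContMDiffOn 𝓘(ℝ, ℝ × ℝ) (𝓡 d) ∞ Q W := by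
    refine H.contMDiffOn_val_space hW (hAp.pinv.pcomp hBp fun z _ => ?_) (fun z _ => ?_)
      fun z _ => ?_
    · simp [A, B]
    · simp [p.source]
    · simp [p.source]
  have hQ1 : ∀ z ∈ W, A z = B z → Q z = 1 := fun z hz h => by
    simp only [Q, ← h]
    exact H.val_thin (isThin_pinv_pcomp (hAp.piecewiseSmooth hz).1)
  have key := hasMFDerivAt_diag_of_const_axes (Q := Q) (g := 1)
    ((hQ.contMDiffAt (hW.mem_nhds hW0)).mdifferentiableAt (by simp)) ?_ ?_
  -- It remains to move the base parameter from 0 to `j` and to recognize `Q` on the diagonal.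
  · have key' : HasMFDerivAt 𝓘(ℝ, ℝ) (𝓡 d) (fun s : ℝ => Q (s, s)) (j - j)
        (0 : ℝ →L[ℝ] EuclideanSpace ℝ (Fin d)) := by rw [sub_self]; exact key
    have hsub : HasMFDerivAt 𝓘(ℝ, ℝ) 𝓘(ℝ, ℝ) (fun i : ℝ => i - j) j (ContinuousLinearMap.id ℝ ℝ) :=
      ((hasFDerivAt_id j).sub_const j).hasMFDerivAt
    have hcomp := HasMFDerivAt.comp (f := fun i : ℝ => i - j) j key' hsub
    have e0 : (0 : ℝ →L[ℝ] EuclideanSpace ℝ (Fin d)).comp (ContinuousLinearMap.id ℝ ℝ) = 0 := by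
      simp
    refine (hcomp.congr_mfderiv e0).congr_of_eventuallyEq ?_
    obtain ⟨τ, hτ, hτw⟩ := Metric.eventually_nhds_iff_ball.1 hρw
    filter_upwards [Metric.ball_mem_nhds j (lt_min hτ hδ)] with i hi
    have hi' : |i - j| < min τ δ := by simpa [Real.dist_eq] using hi
    have hti : ∀ t ∈ Icc (0 : ℝ) 1, c (r (j + t * (i - j))) = c x + (t * (i - j)) • w (t * (i - j)) ∧
        r (j + t * (i - j)) ∈ c.source := by
      intro t ht
      have h1 : |t * (i - j)| < min τ δ := by
        rw [abs_mul, abs_of_nonneg ht.1]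
        nlinarith [ht.2, ht.1, abs_nonneg (i - j)]
      have h2 := hτw (t * (i - j)) (by simpa using h1.trans_le (min_le_left _ _))
      refine ⟨?_, (hδV (hmem _ (by simpa using h1.trans_le (min_le_right _ _)))).2⟩
      rw [← h2]; simp [ρ]
    have eA : arc r j i = A (i - j, i - j) := by
      funext t
      obtain ⟨h1, h2⟩ := hti t t.2
      simp only [arc, A]
      rw [← h1, c.left_inv h2]
    have eB : radialPath (n := n) x (r i) = B (i - j, i - j) := by
      funext t
      obtain ⟨h1, -⟩ := hti 1 (by simp)
      have h1' : c (r i) - c x = (i - j) • w (1 * (i - j)) := by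
        simpa [sub_eq_iff_eq_add, add_comm] using h1
      simp only [radialPath, B, mul_smul]
      rw [← h1']
    simp only [Q, eA, eB, Function.comp_apply]
  -- On the first axis both families use only `w 0`; on the second, treated next, all paths are
  -- constant.
  · filter_upwards [Metric.ball_mem_nhds (0 : ℝ) hη] with s hs
    refine hQ1 _ ⟨hs, Metric.mem_ball_self one_pos⟩ ?_
    funext t; simp [A, B]
  · filter_upwards [Metric.ball_mem_nhds (0 : ℝ) one_pos] with s hs
    refine hQ1 _ ⟨Metric.mem_ball_self hη, hs⟩ ?_
    funext t; simp [A, B]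

end HolonomyMap

end KeyLemma

/-! ### Local trivializations and their differentials. -/

section Frame

variable {n d : ℕ} {M : Type*} [TopologicalSpace M] [ChartedSpace (Euc n) M]
  {b : M} {G : Type*} [Group G] [TopologicalSpace G] [ChartedSpace (Euc d) G]

/-- By the product rule only the partial differential of multiplication in the second factor enters,
and left multiplication by `q j = 1` is the identity. This discards the correction factor between
segments and arcs. -/
theorem hasMFDerivAt_mul_of_one_of_zero [LieGroup (𝓡 d) ∞ G] {q f : ℝ → G} {j : ℝ}
    {D : ℝ →L[ℝ] EuclideanSpace ℝ (Fin d)} (hq1 : q j = 1)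
    (hq : HasMFDerivAt 𝓘(ℝ, ℝ) (𝓡 d) q j (0 : ℝ →L[ℝ] EuclideanSpace ℝ (Fin d)))
    (hf : HasMFDerivAt 𝓘(ℝ, ℝ) (𝓡 d) f j D) :
    HasMFDerivAt 𝓘(ℝ, ℝ) (𝓡 d) (fun i => q i * f i) j D := by
  obtain ⟨L, hL⟩ : ∃ L : (EuclideanSpace ℝ (Fin d) × EuclideanSpace ℝ (Fin d)) →L[ℝ]
      EuclideanSpace ℝ (Fin d),
      HasMFDerivAt ((𝓡 d).prod (𝓡 d)) (𝓡 d) (fun z : G × G => z.1 * z.2) (q j, f j) L :=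
    ⟨_, ((contMDiff_mul (𝓡 d) ∞).mdifferentiableAt (by simp)).hasMFDerivAt⟩
  have h1 : HasMFDerivAt 𝓘(ℝ, ℝ) (𝓡 d) (fun i => q i * f i) j
      (L.comp ((0 : ℝ →L[ℝ] EuclideanSpace ℝ (Fin d)).prod D)) :=
    HasMFDerivAt.comp (f := fun i => (q i, f i)) j hL (hq.prodMk hf)
  have h2 : HasMFDerivAt (𝓡 d) (𝓡 d) (fun y : G => q j * y) (f j)
      (L.comp ((0 : EuclideanSpace ℝ (Fin d) →L[ℝ] EuclideanSpace ℝ (Fin d)).prod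
        (ContinuousLinearMap.id ℝ _))) :=
    HasMFDerivAt.comp (f := fun y : G => (q j, y)) (f j) hL
      ((hasMFDerivAt_const (q j) (f j)).prodMk (hasMFDerivAt_id (f j)))
  have h3 : HasMFDerivAt (𝓡 d) (𝓡 d) (fun y : G => q j * y) (f j)
      (ContinuousLinearMap.id ℝ (EuclideanSpace ℝ (Fin d))) := by
    exact (hasMFDerivAt_id (f j)).congr_of_eventuallyEq
      (Eventually.of_forall fun y => by simp [hq1])
  have h4 := hasMFDerivAt_unique h2 h3
  refine h1.congr_mfderiv ?_
  exact ContinuousLinearMap.ext fun t => DFunLike.congr_fun h4 (D t)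

theorem HolonomyMap.cls_eq_localFamily (H : HolonomyMap n d b G)
    (ψ : LocalFamily n b) {p : BasedPath n b} (hp : p 1 ∈ ψ.U) (g : G) :
    H.cls p g = H.cls (ψ (p 1)) (H.val (pinv p ⊙ (ψ (p 1) : unitInterval → M)) * g) :=
  H.cls_eq_cls.2 ⟨(ψ.tip _ hp).symm, rfl⟩

variable [IsManifold (𝓡 n) ∞ M]

/-- Around the end point of a path there is a smooth family of paths which prolongs it by straight
segments. -/
theorem exists_radial_localFamily (p : BasedPath n b) : ∃ ψ : LocalFamily n b, p 1 ∈ ψ.U ∧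
    ∀ u ∈ ψ.U, (ψ u : unitInterval → M) = radialPath (n := n) (p 1) u ⊙ p := by
  classical
  set x := p 1 with hx
  let c := chartAt (Euc n) x
  obtain ⟨ε, hε, hball⟩ := Metric.isOpen_iff.1 c.open_target (c x) (mem_chart_target _ x)
  have hsrc : ContMDiffOn (𝓡 n) (𝓡 n) ∞ c c.source := contMDiffOn_chart
  have htgt : ContMDiffOn (𝓡 n) (𝓡 n) ∞ c.symm c.target := contMDiffOn_chart_symm
  let U := c.source ∩ c ⁻¹' Metric.ball (c x) ε
  have hU : IsOpen U := c.isOpen_inter_preimage Metric.isOpen_ball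
  have hτ : ContMDiffOn ((𝓡 n).prod 𝓘(ℝ, ℝ)) (𝓡 n) ∞
      (fun z : M × ℝ => c x + z.2 • (c z.1 - c x)) (U ×ˢ Icc 0 1) := by
    have hc : ContMDiffOn ((𝓡 n).prod 𝓘(ℝ, ℝ)) (𝓡 n) ∞ (fun z : M × ℝ => c z.1)
        (U ×ˢ Icc 0 1) := hsrc.comp contMDiff_fst.contMDiffOn (fun z hz => hz.1.1)
    exact contMDiffOn_const.add (contMDiff_snd.contMDiffOn.smul (hc.sub contMDiffOn_const))
  have hfam : SmoothFamilyOn n (𝓡 n) U (radialPath (n := n) x) := by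
    refine smoothFamilyOn_of_contMDiffOn
      (f := fun z : M × ℝ => c.symm (c x + z.2 • (c z.1 - c x))) ?_
    refine htgt.comp hτ fun z hz => hball ?_
    have h1 : ‖c z.1 - c x‖ < ε := by rw [← dist_eq_norm]; exact hz.1.2
    rw [Metric.mem_ball, dist_self_add_left, norm_smul, Real.norm_of_nonneg hz.2.1]
    nlinarith [norm_nonneg (c z.1 - c x), hz.2.1, hz.2.2]
  have h0 : ∀ u, radialPath (n := n) x u 0 = x := fun u => by simp [radialPath]
  have h1 : ∀ u ∈ U, radialPath (n := n) x u 1 = u := fun u hu => by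
    simpa [radialPath] using c.left_inv hu.1
  have hfam' := hfam.pcomp (SmoothFamilyOn.const p.smooth U) fun u _ => (h0 u).symm
  -- Outside `U` the straight segment may leave the chart, so a constant path fills in; only the
  -- values on `U` matter.
  refine ⟨⟨U, hU, fun u => if hu : u ∈ U then
      ⟨radialPath (n := n) x u ⊙ p, hfam'.piecewiseSmooth hu, by simp [p.source]⟩
      else constPath n b, ?_, ?_⟩, ⟨mem_chart_source _ x, Metric.mem_ball_self hε⟩, ?_⟩
  · exact hfam'.congr (fun u hu => by simp [hu])
  · intro u hu; simp [hu, h1 u hu]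
  · intro u hu
    have hu' : u ∈ U := hu
    simp [hu']

namespace HolonomyMap

variable [LieGroup (𝓡 d) ∞ G] (H : HolonomyMap n d b G)

variable [ConnectedSpace M]

/-- The charts of E are the inverse trivialization followed by a chart `c` of M × G. Near a point
the map is therefore the inverse of such a chart after `c`. -/
theorem contMDiffOn_cls_localFamily (ψ : LocalFamily n b) :
    ContMDiffOn ((𝓡 n).prod (𝓡 d)) ((𝓡 n).prod (𝓡 d)) ∞
      (fun z : M × G => H.cls (ψ z.1) z.2) (ψ.U ×ˢ univ) := by
  have : ContMDiffMul (𝓡 d) ∞ G := inferInstance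
  have : IsManifold (𝓡 d) ∞ G := this.toIsManifold
  intro z hz
  let c := chartAt (ModelProd (Euc n) (Euc d)) z
  have h1 := contMDiffOn_symm_of_mem_maximalAtlas (I := (𝓡 n).prod (𝓡 d)) (n := ∞)
    (StructureGroupoid.subset_maximalAtlas _
      (show H.localTriv ψ ≫ₕ c ∈ atlas (ModelProd (Euc n) (Euc d)) H.Total from
        ⟨ψ, c, chart_mem_atlas _ z, rfl⟩))
  have h2 : ContMDiffOn ((𝓡 n).prod (𝓡 d)) ((𝓡 n).prod (𝓡 d)) ∞ c c.source := contMDiffOn_chart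
  have hW : c.source ∩ ψ.U ×ˢ univ ∈ 𝓝 z :=
    (c.open_source.inter (ψ.isOpen.prod isOpen_univ)).mem_nhds ⟨mem_chart_source _ z, hz⟩
  have h3 : ContMDiffOn ((𝓡 n).prod (𝓡 d)) ((𝓡 n).prod (𝓡 d)) ∞
      (fun z : M × G => H.cls (ψ z.1) z.2) (c.source ∩ ψ.U ×ˢ univ) := by
    refine (h1.comp (h2.mono inter_subset_left) ?_).congr ?_
    · intro y hy
      have hy2 : y ∈ (H.localTriv ψ).target := hy.2
      simp only [mfld_simps]
      exact ⟨c.map_source hy.1, by simpa [c.left_inv hy.1] using hy2⟩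
    · intro y hy
      simp only [Function.comp_apply, OpenPartialHomeomorph.coe_trans_symm, c.left_inv hy.1]
      rfl
  exact (h3.contMDiffAt hW).contMDiffWithinAt

/-- Locally this is a chart of E followed by the inverse of a chart of M × G. -/
theorem contMDiffOn_localTriv (ψ : LocalFamily n b) :
    ContMDiffOn ((𝓡 n).prod (𝓡 d)) ((𝓡 n).prod (𝓡 d)) ∞
      (H.localTriv ψ) (H.localTriv ψ).source := by
  have : ContMDiffMul (𝓡 d) ∞ G := inferInstance
  have : IsManifold (𝓡 d) ∞ G := this.toIsManifold
  intro a ha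
  let c := chartAt (ModelProd (Euc n) (Euc d)) (H.localTriv ψ a)
  have h1 := contMDiffOn_of_mem_maximalAtlas (I := (𝓡 n).prod (𝓡 d)) (n := ∞)
    (StructureGroupoid.subset_maximalAtlas _
      (show H.localTriv ψ ≫ₕ c ∈ atlas (ModelProd (Euc n) (Euc d)) H.Total from
        ⟨ψ, c, chart_mem_atlas _ _, rfl⟩))
  have h2 : ContMDiffOn ((𝓡 n).prod (𝓡 d)) ((𝓡 n).prod (𝓡 d)) ∞ c.symm c.target :=
    contMDiffOn_chart_symm
  have h3 : ContMDiffOn ((𝓡 n).prod (𝓡 d)) ((𝓡 n).prod (𝓡 d)) ∞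
      (H.localTriv ψ) (H.localTriv ψ ≫ₕ c).source := by
    refine (h2.comp h1 ?_).congr ?_
    · intro y hy
      exact c.map_source (by simp only [mfld_simps] at hy; exact hy.2)
    · intro y hy
      simp only [mfld_simps] at hy
      simp only [Function.comp_apply, OpenPartialHomeomorph.coe_trans, c.left_inv hy.2]
  refine (h3.contMDiffAt ((H.localTriv ψ ≫ₕ c).open_source.mem_nhds ?_)).contMDiffWithinAt
  simp only [mfld_simps]
  exact ⟨ha, mem_chart_source _ _⟩

/-- The differential of a local trivialization is a linear isomorphism, the first component of
whose inverse is the differential of the projection. -/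
theorem exists_hasMFDerivAt_cls_localFamily (ψ : LocalFamily n b) {x : M} (hx : x ∈ ψ.U) (g : G) :
    ∃ T : (EuclideanSpace ℝ (Fin n) × EuclideanSpace ℝ (Fin d)) →L[ℝ]
        (EuclideanSpace ℝ (Fin n) × EuclideanSpace ℝ (Fin d)),
      HasMFDerivAt ((𝓡 n).prod (𝓡 d)) ((𝓡 n).prod (𝓡 d))
        (fun z : M × G => H.cls (ψ z.1) z.2) (x, g) T ∧ Function.Bijective T ∧
      ∀ v η, mfderiv ((𝓡 n).prod (𝓡 d)) (𝓡 n) H.proj (H.cls (ψ x) g) (T (v, η)) = v := by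
  let Ψ : M × G → H.Total := fun z => H.cls (ψ z.1) z.2
  have hU : ψ.U ×ˢ (univ : Set G) ∈ 𝓝 (x, g) := (ψ.isOpen.prod isOpen_univ).mem_nhds ⟨hx, trivial⟩
  have ha : Ψ (x, g) ∈ (H.localTriv ψ).source := (H.localTriv ψ).map_target' (x := (x, g)) ⟨hx, trivial⟩
  have hΨx : H.localTriv ψ (Ψ (x, g)) = (x, g) := (H.localTriv ψ).right_inv ⟨hx, trivial⟩
  have hsrc := (H.localTriv ψ).open_source.mem_nhds ha
  -- Differentials are retyped as maps between the model spaces, so that the linear algebra does not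
  -- depend on base points.
  obtain ⟨T, hT⟩ : ∃ T : (EuclideanSpace ℝ (Fin n) × EuclideanSpace ℝ (Fin d)) →L[ℝ]
      (EuclideanSpace ℝ (Fin n) × EuclideanSpace ℝ (Fin d)),
      HasMFDerivAt ((𝓡 n).prod (𝓡 d)) ((𝓡 n).prod (𝓡 d)) Ψ (x, g) T :=
    ⟨_, (((H.contMDiffOn_cls_localFamily ψ).contMDiffAt hU).mdifferentiableAt
      (by simp)).hasMFDerivAt⟩
  obtain ⟨S, hS⟩ : ∃ S : (EuclideanSpace ℝ (Fin n) × EuclideanSpace ℝ (Fin d)) →L[ℝ]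
      (EuclideanSpace ℝ (Fin n) × EuclideanSpace ℝ (Fin d)),
      HasMFDerivAt ((𝓡 n).prod (𝓡 d)) ((𝓡 n).prod (𝓡 d)) (H.localTriv ψ) (Ψ (x, g)) S :=
    ⟨_, (((H.contMDiffOn_localTriv ψ).contMDiffAt hsrc).mdifferentiableAt (by simp)).hasMFDerivAt⟩
  have hTS : T.comp S = ContinuousLinearMap.id ℝ _ := by
    have hT' : HasMFDerivAt ((𝓡 n).prod (𝓡 d)) ((𝓡 n).prod (𝓡 d)) Ψ
        (H.localTriv ψ (Ψ (x, g))) T := by rw [hΨx]; exact hT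
    refine hasMFDerivAt_unique (hT'.comp _ hS) ((hasMFDerivAt_id _).congr_of_eventuallyEq ?_)
    filter_upwards [hsrc] with a ha
    exact (H.localTriv ψ).left_inv ha
  have hST : S.comp T = ContinuousLinearMap.id ℝ _ := by
    refine hasMFDerivAt_unique (hS.comp _ hT) ((hasMFDerivAt_id _).congr_of_eventuallyEq ?_)
    filter_upwards [hU] with z hz
    exact (H.localTriv ψ).right_inv hz
  have hST' : ∀ w, S (T w) = w := fun w => DFunLike.congr_fun hST w
  refine ⟨T, hT, ⟨Function.LeftInverse.injective (g := S) hST',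
    Function.RightInverse.surjective (g := S) fun w => DFunLike.congr_fun hTS w⟩, fun v η => ?_⟩
  -- The projection is the first component of the inverse trivialization.
  have hπ : HasMFDerivAt ((𝓡 n).prod (𝓡 d)) (𝓡 n) H.proj (Ψ (x, g))
      ((ContinuousLinearMap.fst ℝ (EuclideanSpace ℝ (Fin n)) (EuclideanSpace ℝ (Fin d))).comp S) :=
    HasMFDerivAt.comp (g := Prod.fst) _ (hasMFDerivAt_fst _) hS
  change mfderiv ((𝓡 n).prod (𝓡 d)) (𝓡 n) H.proj (Ψ (x, g)) (T (v, η)) = v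
  rw [hπ.mfderiv]
  exact congrArg Prod.fst (hST' (v, η))

end HolonomyMap

end Frame

/-! ### Curves and based paths with prescribed velocity. -/

section Curves

variable {n : ℕ} {M : Type*} [TopologicalSpace M] [ChartedSpace (Euc n) M]
  [IsManifold (𝓡 n) ∞ M]

theorem exists_curve_hasMFDerivAt (x : M) (v : EuclideanSpace ℝ (Fin n)) (j : ℝ) :
    ∃ (k : ℝ → M) (δ : ℝ), 0 < δ ∧ ContMDiffOn 𝓘(ℝ, ℝ) (𝓡 n) ∞ k (Metric.ball j δ) ∧ k j = x ∧
      HasMFDerivAt 𝓘(ℝ, ℝ) (𝓡 n) k j ((1 : ℝ →L[ℝ] ℝ).smulRight v) := by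
  let c := chartAt (Euc n) x
  have hct : ContMDiffOn (𝓡 n) (𝓡 n) ∞ c.symm c.target := contMDiffOn_chart_symm
  have hxt : c x ∈ c.target := mem_chart_target _ x
  have hmd : c.MDifferentiable (𝓡 n) (𝓡 n) := mdifferentiable_chart x
  obtain ⟨(u : EuclideanSpace ℝ (Fin n)), hu⟩ := hmd.symm.mfderiv_surjective hxt v
  have hline : ContDiff ℝ ∞ fun t : ℝ => c x + (t - j) • u := by fun_prop
  obtain ⟨δ, hδ, hball⟩ : ∃ δ > 0, Metric.ball j δ ⊆ (fun t : ℝ => c x + (t - j) • u) ⁻¹' c.target := by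
    refine Metric.mem_nhds_iff.1 (hline.continuous.continuousAt.preimage_mem_nhds ?_)
    simpa using c.open_target.mem_nhds hxt
  refine ⟨fun t => c.symm (c x + (t - j) • u), δ, hδ,
    hct.comp hline.contMDiff.contMDiffOn hball, by simp [c], ?_⟩
  have h1 : HasMFDerivAt 𝓘(ℝ, ℝ) (𝓡 n) (fun t : ℝ => c x + (t - j) • u) j
      ((1 : ℝ →L[ℝ] ℝ).smulRight u) := by
    have : HasDerivAt (fun t : ℝ => c x + (t - j) • u) u j := by
      simpa using (((hasDerivAt_id j).sub_const j).smul_const u).const_add (c x)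
    exact this.hasFDerivAt.hasMFDerivAt
  have h2 : HasMFDerivAt (𝓡 n) (𝓡 n) c.symm (c x + (j - j) • u)
      (mfderiv (𝓡 n) (𝓡 n) c.symm (c x)) := by
    have e : c x + (j - j) • u = c x := by simp
    rw [e]
    exact (hmd.mdifferentiableAt_symm hxt).hasMFDerivAt
  refine (HasMFDerivAt.comp (f := fun t : ℝ => c x + (t - j) • u) j h2 h1).congr_mfderiv ?_
  refine ContinuousLinearMap.ext fun t => ?_
  have h3 := (mfderiv (𝓡 n) (𝓡 n) c.symm (c x)).map_smul (t : ℝ) u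
  rw [hu] at h3
  exact h3

/-- Connectedness provides a path from the base point to the start of a short curve with velocity
`v`. The curve is run through in the second half of the composite, with the prescribed point at the
interior time 3/4. -/
theorem exists_basedPath_hasMFDerivAt {b : M} [ConnectedSpace M] (x : M)
    (v : EuclideanSpace ℝ (Fin n)) :
    ∃ (r : BasedPath n b) (j : ℝ) (δ : ℝ), 0 < δ ∧ Metric.ball j δ ⊆ Ioo 0 1 ∧
      ContMDiffOn 𝓘(ℝ, ℝ) (𝓡 n) ∞ (IccExtend zero_le_one (r : unitInterval → M)) (Metric.ball j δ) ∧
      IccExtend zero_le_one (r : unitInterval → M) j = x ∧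
      HasMFDerivAt 𝓘(ℝ, ℝ) (𝓡 n) (IccExtend zero_le_one (r : unitInterval → M)) j
        ((1 : ℝ →L[ℝ] ℝ).smulRight v) := by
  obtain ⟨k, δ, hδ, hk, hk0, hkd⟩ := exists_curve_hasMFDerivAt x v 0
  -- A global reparametrization bounded by δ/2, with value 0 and derivative 1 at 3/4. It keeps `k ∘
  -- φ` smooth on all of ℝ although `k` is controlled only on a ball.
  let φ : ℝ → ℝ := fun t => δ / 2 * Real.sin ((2 * t - 3 / 2) / δ)
  have hφ : ContDiff ℝ ∞ φ := by
    simp only [φ]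
    fun_prop
  have hφ0 : φ (3 / 4) = 0 := by
    have : (2 * (3 / 4) - 3 / 2 : ℝ) / δ = 0 := by norm_num
    simp only [φ, this, Real.sin_zero, mul_zero]
  have hφm : ∀ t, φ t ∈ Metric.ball 0 δ := fun t => by
    have h1 := Real.abs_sin_le_one ((2 * t - 3 / 2) / δ)
    rw [mem_ball_zero_iff, Real.norm_eq_abs]
    simp only [φ]
    rw [abs_mul, abs_of_pos (half_pos hδ)]
    nlinarith
  have hφd : HasDerivAt φ 1 (3 / 4) := by
    have h1 : HasDerivAt (fun t : ℝ => (2 * t - 3 / 2) / δ) (2 * 1 / δ) (3 / 4) :=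
      (((hasDerivAt_id (3 / 4 : ℝ)).const_mul 2).sub_const (3 / 2)).div_const δ
    have h2 := (h1.sin).const_mul (δ / 2)
    have e : (2 * (3 / 4) - 3 / 2 : ℝ) / δ = 0 := by norm_num
    rw [e, Real.cos_zero] at h2
    have e2 : δ / 2 * (1 * (2 * 1 / δ)) = 1 := by field_simp
    rw [e2] at h2
    exact h2
  have hkφ : ContMDiff 𝓘(ℝ, ℝ) (𝓡 n) ∞ (k ∘ φ) := by
    rw [← contMDiffOn_univ]
    exact hk.comp hφ.contMDiff.contMDiffOn fun t _ => hφm t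
  have hkφd : HasMFDerivAt 𝓘(ℝ, ℝ) (𝓡 n) (k ∘ φ) (3 / 4) ((1 : ℝ →L[ℝ] ℝ).smulRight v) := by
    have hkd' : HasMFDerivAt 𝓘(ℝ, ℝ) (𝓡 n) k (φ (3 / 4)) ((1 : ℝ →L[ℝ] ℝ).smulRight v) := by
      rw [hφ0]; exact hkd
    refine (hkd'.comp _ hφd.hasFDerivAt.hasMFDerivAt).congr_mfderiv ?_
    refine ContinuousLinearMap.ext fun (t : ℝ) => ?_
    change (t • (1 : ℝ)) • v = t • v
    simp
  -- The composite runs `s` at time `2t - 1` on its second half, so there it equals `k ∘ φ` at time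
  -- `t`, without rescaling the velocity.
  let s : unitInterval → M := fun t => k (φ ((t + 1) / 2))
  have hs : PiecewiseSmooth n s := by
    have := smoothFamilyOn_of_contMDiffOn (n := n) (J := 𝓘(ℝ, ℝ)) (U := (univ : Set ℝ))
      (f := fun z : ℝ × ℝ => (k ∘ φ) ((z.2 + 1) / 2))
      (hkφ.comp (contMDiff_of_contDiff_prod (by fun_prop : ContDiff ℝ ∞ fun z : ℝ × ℝ =>
        (z.2 + 1) / 2))).contMDiffOn
    exact this.piecewiseSmooth (mem_univ 0)
  obtain ⟨p, hp⟩ := exists_basedPath (n := n) (b := b) (s 0)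
  have hext : ∀ t ∈ Metric.ball (3 / 4 : ℝ) (1 / 4),
      IccExtend zero_le_one (p.prolong s hs hp : unitInterval → M) t = (k ∘ φ) t := by
    intro t ht
    rw [Real.ball_eq_Ioo] at ht
    have ht1 : t ∈ Icc (0 : ℝ) 1 := ⟨by linarith [ht.1], by linarith [ht.2]⟩
    have ht2 : 2 * t - 1 ∈ Icc (0 : ℝ) 1 := ⟨by linarith [ht.1], by linarith [ht.2]⟩
    rw [IccExtend_of_mem _ _ ht1]
    simp only [BasedPath.prolong, LoopHolonomy.pcomp]
    rw [if_neg (by linarith [ht.1]), IccExtend_of_mem _ _ ht2]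
    simp only [s, Function.comp_apply]
    ring_nf
  refine ⟨p.prolong s hs hp, 3 / 4, 1 / 4, by norm_num, ?_, hkφ.contMDiffOn.congr hext, ?_,
    hkφd.congr_of_eventuallyEq ?_⟩
  · rw [Real.ball_eq_Ioo]
    exact Ioo_subset_Ioo (by norm_num) (by norm_num)
  · rw [hext _ (Metric.mem_ball_self (by norm_num)), Function.comp_apply, hφ0, hk0]
  · filter_upwards [Metric.ball_mem_nhds (3 / 4 : ℝ) (by norm_num : (0 : ℝ) < 1 / 4)] with t ht
    exact hext t ht

end Curves

/-! ### Differentials of left translations. -/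

section LeftTranslation

variable {d : ℕ} {G : Type*} [Group G] [TopologicalSpace G] [ChartedSpace (Euc d) G]
  [LieGroup (𝓡 d) ∞ G]

theorem mfderiv_inv_mul_mfderiv_mul (g : G) (ξ : EuclideanSpace ℝ (Fin d)) :
    mfderiv (𝓡 d) (𝓡 d) (fun x : G => g⁻¹ * x) g
      (mfderiv (𝓡 d) (𝓡 d) (fun h : G => g * h) 1 ξ) = ξ := by
  have hd : ∀ g x : G, MDifferentiableAt (𝓡 d) (𝓡 d) (fun y : G => g * y) x := fun g x =>
    (contMDiff_mul_left (I := 𝓡 d) (n := ∞)).mdifferentiableAt (by simp)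
  have h1 : HasMFDerivAt (𝓡 d) (𝓡 d) (fun y : G => g⁻¹ * y) (g * 1)
      (mfderiv (𝓡 d) (𝓡 d) (fun x : G => g⁻¹ * x) g) := by
    rw [mul_one]; exact (hd _ _).hasMFDerivAt
  have h2 := hasMFDerivAt_unique (HasMFDerivAt.comp (f := fun h : G => g * h) (1 : G) h1
    (hd g 1).hasMFDerivAt) ((hasMFDerivAt_id (1 : G)).congr_of_eventuallyEq
      (Eventually.of_forall fun y => by simp))
  exact DFunLike.congr_fun h2 ξ

theorem mfderiv_mul_mfderiv_inv_mul (g : G) (η : EuclideanSpace ℝ (Fin d)) :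
    mfderiv (𝓡 d) (𝓡 d) (fun h : G => g * h) 1
      (mfderiv (𝓡 d) (𝓡 d) (fun x : G => g⁻¹ * x) g η) = η := by
  have hd : ∀ g x : G, MDifferentiableAt (𝓡 d) (𝓡 d) (fun y : G => g * y) x := fun g x =>
    (contMDiff_mul_left (I := 𝓡 d) (n := ∞)).mdifferentiableAt (by simp)
  have h1 : HasMFDerivAt (𝓡 d) (𝓡 d) (fun y : G => g * y) (g⁻¹ * g)
      (mfderiv (𝓡 d) (𝓡 d) (fun x : G => g * x) 1) := by
    rw [inv_mul_cancel]; exact (hd _ _).hasMFDerivAt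
  have h2 := hasMFDerivAt_unique (HasMFDerivAt.comp (f := fun h : G => g⁻¹ * h) g h1
    (hd _ g).hasMFDerivAt) ((hasMFDerivAt_id g).congr_of_eventuallyEq
      (Eventually.of_forall fun y => by simp))
  exact DFunLike.congr_fun h2 η

end LeftTranslation

/-! ### A frame adapted to parallel transport. -/

section Frame

variable {n d : ℕ} {M : Type*} [TopologicalSpace M] [ChartedSpace (Euc n) M] [IsManifold (𝓡 n) ∞ M]
  {b : M} {G : Type*} [Group G] [TopologicalSpace G] [ChartedSpace (Euc d) G]

namespace HolonomyMap

variable [LieGroup (𝓡 d) ∞ G] [ConnectedSpace M] (H : HolonomyMap n d b G)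

/-- A linear frame of the tangent space at `{p,g}` which is adapted to the vertical subspace and
to parallel transport: the velocity of `{χ[i],γ(i)}` has the components `d/di χ[i](1)` and
`d/di H(χ[i]⁻¹ ∘ c ∘ p) γ(i)`, where `c` is the arc from `p(1)` to `χ[i](1)`. -/
theorem exists_frame (p : BasedPath n b) (g : G) :
    ∃ T : (EuclideanSpace ℝ (Fin n) × EuclideanSpace ℝ (Fin d)) →L[ℝ]
        (EuclideanSpace ℝ (Fin n) × EuclideanSpace ℝ (Fin d)),
      Function.Bijective T ∧
      (∀ v η, mfderiv ((𝓡 n).prod (𝓡 d)) (𝓡 n) H.proj (H.cls p g) (T (v, η)) = v) ∧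
      (∀ ξ, H.orbitDeriv (H.cls p g) ξ =
        T (0, mfderiv (𝓡 d) (𝓡 d) (fun h : G => g * h) 1 ξ)) ∧
      ∀ (χ : ℝ → BasedPath n b) (γ : ℝ → G) (j : ℝ) (V : Set ℝ) (R : ℝ →L[ℝ] EuclideanSpace ℝ (Fin n))
        (D : ℝ →L[ℝ] EuclideanSpace ℝ (Fin d)), V ∈ 𝓝 j →
        ContMDiffOn 𝓘(ℝ, ℝ) (𝓡 n) ∞ (fun i => χ i 1) V → χ j 1 = p 1 →
        HasMFDerivAt 𝓘(ℝ, ℝ) (𝓡 n) (fun i => χ i 1) j R →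
        HasMFDerivAt 𝓘(ℝ, ℝ) (𝓡 d)
          (fun i => H.val (pinv (χ i) ⊙ (arc (fun k => χ k 1) j i ⊙ p)) * γ i) j D →
        H.val (pinv (χ j) ⊙ (arc (fun k => χ k 1) j j ⊙ p)) * γ j = g →
        HasMFDerivAt 𝓘(ℝ, ℝ) ((𝓡 n).prod (𝓡 d)) (fun i => H.cls (χ i) (γ i)) j
          (T.comp (R.prod D)) := by
  obtain ⟨ψ, hpψ, hψ⟩ := exists_radial_localFamily p
  obtain ⟨T, hT, hbij, hπ⟩ := H.exists_hasMFDerivAt_cls_localFamily ψ hpψ g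
  have hψ1 : (ψ (p 1) : unitInterval → M) = (fun _ => p 1) ⊙ p := by
    rw [hψ _ hpψ, radialPath_self]
  -- At its centre the radial family prolongs `p` by a constant path, which does not change the
  -- class.
  have hcls : ∀ h, H.cls p h = H.cls (ψ (p 1)) h := fun h => by
    rw [H.cls_eq_localFamily ψ hpψ, hψ1, H.val_thin (isThin_const_pcomp p.smooth.1), one_mul]
  refine ⟨T, hbij, ?_, fun ξ => ?_, ?_⟩
  · rw [hcls]; exact hπ
  · obtain ⟨L, hL⟩ : ∃ L : EuclideanSpace ℝ (Fin d) →L[ℝ] EuclideanSpace ℝ (Fin d),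
        HasMFDerivAt (𝓡 d) (𝓡 d) (fun h : G => g * h) 1 L :=
      ⟨_, ((contMDiff_mul_left (I := 𝓡 d) (n := ∞)).mdifferentiableAt (by simp)).hasMFDerivAt⟩
    have hT' : HasMFDerivAt ((𝓡 n).prod (𝓡 d)) ((𝓡 n).prod (𝓡 d))
        (fun z : M × G => H.cls (ψ z.1) z.2) (p 1, g * 1) T := by rw [mul_one]; exact hT
    have h1 : HasMFDerivAt (𝓡 d) ((𝓡 n).prod (𝓡 d)) (fun h : G => H.act (H.cls p g) h) 1
        (T.comp ((0 : EuclideanSpace ℝ (Fin d) →L[ℝ] EuclideanSpace ℝ (Fin n)).prod L)) := by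
      refine (HasMFDerivAt.comp (f := fun h : G => (p 1, g * h)) (1 : G) hT'
        ((hasMFDerivAt_const (p 1) (1 : G)).prodMk hL)).congr_of_eventuallyEq
        (Eventually.of_forall fun h => ?_)
      exact hcls (g * h)
    rw [orbitDeriv, h1.mfderiv, hL.mfderiv]
    rfl
  · intro χ γ j V R D hV hr hj hR hf hfj
    let r : ℝ → M := fun i => χ i 1
    have hrc : ContinuousAt r j := (hr.contMDiffAt hV).continuousAt
    obtain ⟨δ, hδ, hball⟩ : ∃ δ > 0, Metric.ball j δ ⊆ V ∩ r ⁻¹' ψ.U := by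
      refine Metric.mem_nhds_iff.1 (inter_mem hV (hrc.preimage_mem_nhds (ψ.isOpen.mem_nhds ?_)))
      change χ j 1 ∈ _
      rw [hj]; exact hpψ
    let q : ℝ → G := fun i => H.val (pinv (arc r j i ⊙ p) ⊙ (radialPath (n := n) (p 1) (r i) ⊙ p))
    have hq : HasMFDerivAt 𝓘(ℝ, ℝ) (𝓡 d) q j (0 : ℝ →L[ℝ] EuclideanSpace ℝ (Fin d)) :=
      H.hasMFDerivAt_val_arc_radialPath p hV hr hj
    have hq1 : q j = 1 := by
      have e : r j = p 1 := hj
      simp only [q, arc_self, e, radialPath_self]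
      exact H.val_thin (isThin_pinv_pcomp (continuous_pcomp continuous_const p.smooth.1 rfl))
    have hqf := hasMFDerivAt_mul_of_one_of_zero hq1 hq hf
    have hT' : HasMFDerivAt ((𝓡 n).prod (𝓡 d)) ((𝓡 n).prod (𝓡 d))
        (fun z : M × G => H.cls (ψ z.1) z.2)
        (r j, q j * (H.val (pinv (χ j) ⊙ (arc r j j ⊙ p)) * γ j)) T := by
      have e : (r j, q j * (H.val (pinv (χ j) ⊙ (arc r j j ⊙ p)) * γ j)) = (p 1, g) :=
        Prod.ext hj (by rw [hfj, hq1, one_mul])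
      rw [e]; exact hT
    refine (HasMFDerivAt.comp
      (f := fun i => (r i, q i * (H.val (pinv (χ i) ⊙ (arc r j i ⊙ p)) * γ i))) j hT'
      (hR.prodMk hqf)).congr_of_eventuallyEq ?_
    filter_upwards [Metric.ball_mem_nhds j hδ] with i hi
    have hiU : χ i 1 ∈ ψ.U := (hball hi).2
    have harc : PiecewiseSmooth n (arc r j i) :=
      (smoothFamilyOn_arc (convex_ball j δ) (Metric.mem_ball_self hδ)
        (hr.mono fun t ht => (hball ht).1)).piecewiseSmooth hi
    -- Inserting the arc as an intermediate path splits the group component of the trivialization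
    -- into `q i` and the arc expression.
    have htr := H.val_trans (p := χ i) (q := p.prolong (arc r j i) harc (by simp [r, hj]))
      (r := ψ (χ i 1)) (by simp [BasedPath.prolong, r]) (ψ.tip _ hiU)
    rw [H.cls_eq_localFamily ψ hiU, ← htr, hψ _ hiU, mul_assoc]
    rfl

end HolonomyMap

end Frame

/-! ### The splitting of the tangent space and the connection form. -/

section Connection

variable {n d : ℕ} {M : Type*} [TopologicalSpace M] [ChartedSpace (Euc n) M] [IsManifold (𝓡 n) ∞ M]
  {b : M} {G : Type*} [Group G] [TopologicalSpace G] [ChartedSpace (Euc d) G]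

namespace HolonomyMap

variable [LieGroup (𝓡 d) ∞ G] [ConnectedSpace M] (H : HolonomyMap n d b G)

/-- In the frame of `exists_frame` the vertical and the horizontal subspace are the two coordinate
subspaces. -/
theorem exists_frame_splitting (p : BasedPath n b) (g : G) :
    ∃ T : (EuclideanSpace ℝ (Fin n) × EuclideanSpace ℝ (Fin d)) →L[ℝ]
        (EuclideanSpace ℝ (Fin n) × EuclideanSpace ℝ (Fin d)),
      Function.Bijective T ∧
      (∀ v η, T (v, η) ∈ H.vertical (H.cls p g) ↔ v = 0) ∧
      (∀ v η, T (v, η) ∈ H.horizontal (H.cls p g) ↔ η = 0) ∧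
      (∀ ξ, H.orbitDeriv (H.cls p g) ξ =
        T (0, mfderiv (𝓡 d) (𝓡 d) (fun h : G => g * h) 1 ξ)) ∧
      ∀ (χ : ℝ → BasedPath n b) (γ : ℝ → G) (j : ℝ) (V : Set ℝ) (R : ℝ →L[ℝ] EuclideanSpace ℝ (Fin n))
        (D : ℝ →L[ℝ] EuclideanSpace ℝ (Fin d)), V ∈ 𝓝 j →
        ContMDiffOn 𝓘(ℝ, ℝ) (𝓡 n) ∞ (fun i => χ i 1) V → χ j 1 = p 1 →
        HasMFDerivAt 𝓘(ℝ, ℝ) (𝓡 n) (fun i => χ i 1) j R →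
        HasMFDerivAt 𝓘(ℝ, ℝ) (𝓡 d)
          (fun i => H.val (pinv (χ i) ⊙ (arc (fun k => χ k 1) j i ⊙ p)) * γ i) j D →
        H.val (pinv (χ j) ⊙ (arc (fun k => χ k 1) j j ⊙ p)) * γ j = g →
        HasMFDerivAt 𝓘(ℝ, ℝ) ((𝓡 n).prod (𝓡 d)) (fun i => H.cls (χ i) (γ i)) j
          (T.comp (R.prod D)) := by
  obtain ⟨T, hbij, hπ, horb, hcore⟩ := H.exists_frame p g
  -- Generators of Γ_a have no second component: by `val_contr_arc` the group-valued function whose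
  -- derivative it is stays equal to `g`.
  have hlift : ∀ (r : BasedPath n b) (j : ℝ) (h : G) (R : ℝ →L[ℝ] EuclideanSpace ℝ (Fin n)),
      j ∈ Ioo (0 : ℝ) 1 →
      (∀ᶠ t in 𝓝 j, ContMDiffAt 𝓘(ℝ, ℝ) (𝓡 n) ∞ (IccExtend zero_le_one (r : unitInterval → M)) t) →
      H.cls (r.contr (projIcc 0 1 zero_le_one j)) h = H.cls p g →
      HasMFDerivAt 𝓘(ℝ, ℝ) (𝓡 n) (IccExtend zero_le_one (r : unitInterval → M)) j R →
      HasMFDerivAt 𝓘(ℝ, ℝ) ((𝓡 n).prod (𝓡 d))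
        (fun i => H.cls (r.contr (projIcc 0 1 zero_le_one i)) h) j (T.comp (R.prod 0)) := by
    intro r j h R hj hsm hcls hR
    obtain ⟨hc1, hc2⟩ := H.cls_eq_cls.1 hcls
    have hend : (fun i => (r.contr (projIcc 0 1 zero_le_one i)) 1) =
        IccExtend zero_le_one (r : unitInterval → M) := by
      funext i; simp [BasedPath.contr, LoopHolonomy.contr, IccExtend]
    have hrj : r (projIcc 0 1 zero_le_one j) = p 1 := by
      rw [← hc1]; simp [BasedPath.contr, LoopHolonomy.contr]
    -- The ball is also kept inside (0,1), where `projIcc` does nothing.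
    obtain ⟨δ, hδ, hball⟩ := Metric.eventually_nhds_iff_ball.1
      (hsm.and (isOpen_Ioo.mem_nhds hj : ∀ᶠ t in 𝓝 j, t ∈ Ioo (0 : ℝ) 1))
    have hr : ContMDiffOn 𝓘(ℝ, ℝ) (𝓡 n) ∞ (IccExtend zero_le_one (r : unitInterval → M))
        (Metric.ball j δ) := fun t ht => (hball t ht).1.contMDiffWithinAt
    have hval : ∀ i ∈ Metric.ball j δ, H.val (pinv (r.contr (projIcc 0 1 zero_le_one i)) ⊙
        (arc (IccExtend zero_le_one (r : unitInterval → M)) j i ⊙ p)) * h = g := by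
      intro i hi
      have harc := (smoothFamilyOn_arc (convex_ball j δ) (Metric.mem_ball_self hδ)
        hr).piecewiseSmooth hi
      have ei : ((projIcc 0 1 zero_le_one i : unitInterval) : ℝ) = i := by
        rw [projIcc_of_mem _ (Ioo_subset_Icc_self (hball i hi).2)]
      have ej : ((projIcc 0 1 zero_le_one j : unitInterval) : ℝ) = j := by
        rw [projIcc_of_mem _ (Ioo_subset_Icc_self hj)]
      have := H.val_contr_arc (p := p) (r := r) (i := projIcc 0 1 zero_le_one i)
        (j := projIcc 0 1 zero_le_one j) hrj.symm (by rw [ei, ej]; exact harc)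
      rw [ei, ej] at this
      rw [this, hc2]
    refine hcore (fun i => r.contr (projIcc 0 1 zero_le_one i)) (fun _ => h) j (Metric.ball j δ) R 0
      (Metric.ball_mem_nhds j hδ) ?_ hc1 ?_ ?_ ?_
    · rw [hend]; exact hr
    · rw [hend]; exact hR
    · refine (hasMFDerivAt_const g j).congr_of_eventuallyEq ?_
      filter_upwards [Metric.ball_mem_nhds j hδ] with i hi
      rw [hend]; exact hval i hi
    · rw [hend]; exact hval j (Metric.mem_ball_self hδ)
  refine ⟨T, hbij, fun v η => ?_, fun v η => ⟨fun hX => ?_, ?_⟩, horb, hcore⟩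
  · change mfderiv ((𝓡 n).prod (𝓡 d)) (𝓡 n) H.proj (H.cls p g) (T (v, η)) = 0 ↔ v = 0
    exact Eq.congr_left (hπ v η)
  · have key : ∀ X ∈ H.horizontal (H.cls p g),
        ∃ w : EuclideanSpace ℝ (Fin n), X = T (w, 0) := by
      intro X hX
      refine Submodule.span_induction (M := TangentSpace ((𝓡 n).prod (𝓡 d)) (H.cls p g))
        (p := fun X _ => ∃ w : EuclideanSpace ℝ (Fin n), X = T (w, 0)) ?_ ⟨0, ?_⟩ ?_ ?_ hX
      · rintro X ⟨r, j, h, hj, hsm, hcls, rfl⟩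
        have hR := (hsm.self_of_nhds.mdifferentiableAt (by simp)).hasMFDerivAt
        refine ⟨mfderiv 𝓘(ℝ, ℝ) (𝓡 n) (IccExtend zero_le_one (r : unitInterval → M)) j (1 : ℝ), ?_⟩
        rw [velocity, (hlift r j h _ hj hsm hcls hR).mfderiv]
        rfl
      · exact (map_zero T).symm
      · rintro X Y - - ⟨w, rfl⟩ ⟨w', rfl⟩
        have hadd : T (w, 0) + T (w', 0) = T (w + w', 0) := by
          rw [← map_add, Prod.mk_add_mk, add_zero]
        exact ⟨w + w', hadd⟩
      · rintro t X - ⟨w, rfl⟩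
        have hsmul : t • T (w, 0) = T (t • w, 0) := by
          rw [← map_smul, Prod.smul_mk, smul_zero]
        exact ⟨t • w, hsmul⟩
    obtain ⟨w, hw⟩ := key _ hX
    exact congrArg Prod.snd (hbij.1 hw)
  · rintro rfl
    -- Conversely, a based path through `p 1` with velocity `v` has `T (v, 0)` as the velocity of
    -- its lift.
    obtain ⟨r, j, δ, hδ, hsub, hr, hrj, hR⟩ := exists_basedPath_hasMFDerivAt (b := b) (p 1) v
    have hj := hsub (Metric.mem_ball_self hδ)
    have hsm : ∀ᶠ t in 𝓝 j,
        ContMDiffAt 𝓘(ℝ, ℝ) (𝓡 n) ∞ (IccExtend zero_le_one (r : unitInterval → M)) t := by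
      filter_upwards [Metric.ball_mem_nhds j hδ] with t ht
      exact hr.contMDiffAt (Metric.isOpen_ball.mem_nhds ht)
    -- The group element for which the lift of `r` passes through {p,g} at time `j`.
    let h : G := (H.val (pinv (r.contr (projIcc 0 1 zero_le_one j)) ⊙ p))⁻¹ * g
    have hcls : H.cls (r.contr (projIcc 0 1 zero_le_one j)) h = H.cls p g := by
      refine H.cls_eq_cls.2 ⟨?_, by simp [h]⟩
      rw [← hrj]; simp [BasedPath.contr, LoopHolonomy.contr, IccExtend]
    refine Submodule.subset_span ⟨r, j, h, hj, hsm, hcls, ?_⟩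
    rw [velocity, (hlift r j h _ hj hsm hcls hR).mfderiv]
    change T (v, 0) = T ((1 : ℝ) • v, 0)
    rw [one_smul]

theorem isCompl_vertical_horizontal (a : H.Total) :
    IsCompl (H.vertical a) (H.horizontal a) := by
  obtain ⟨⟨p, g⟩, rfl⟩ := H.exists_rep a
  obtain ⟨T, hbij, hv, hh, -, -⟩ := H.exists_frame_splitting p g
  refine ⟨Submodule.disjoint_def.2 fun X hX hX' => ?_,
    Submodule.codisjoint_iff_exists_add_eq.2 fun X => ?_⟩
  · obtain ⟨⟨v, η⟩, rfl⟩ := hbij.2 X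
    obtain rfl := (hv v η).1 hX
    obtain rfl := (hh 0 η).1 hX'
    exact map_zero T
  · obtain ⟨⟨v, η⟩, rfl⟩ := hbij.2 X
    have hadd : T (0, η) + T (v, 0) = T (v, η) := by
      rw [← map_add, Prod.mk_add_mk, add_zero, zero_add]
    exact ⟨T (0, η), T (v, 0), (hv 0 η).2 rfl, (hh v 0).2 rfl, hadd⟩

theorem injective_orbitDeriv (a : H.Total) : Function.Injective (H.orbitDeriv a) := by
  obtain ⟨⟨p, g⟩, rfl⟩ := H.exists_rep a
  obtain ⟨T, hbij, -, -, ho, -⟩ := H.exists_frame_splitting p g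
  intro ξ ξ' h
  rw [ho, ho] at h
  have h1 := congrArg (fun w : EuclideanSpace ℝ (Fin d) =>
    (mfderiv (𝓡 d) (𝓡 d) (fun x : G => g⁻¹ * x) g w : EuclideanSpace ℝ (Fin d)))
    (congrArg Prod.snd (hbij.1 h))
  exact (mfderiv_inv_mul_mfderiv_mul g ξ).symm.trans (h1.trans (mfderiv_inv_mul_mfderiv_mul g ξ'))

theorem range_orbitDeriv (a : H.Total) : range (H.orbitDeriv a) = H.vertical a := by
  obtain ⟨⟨p, g⟩, rfl⟩ := H.exists_rep a
  obtain ⟨T, hbij, hv, -, ho, -⟩ := H.exists_frame_splitting p g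
  apply Subset.antisymm
  · rintro _ ⟨ξ, rfl⟩
    rw [ho]
    exact (hv _ _).2 rfl
  · intro X hX
    obtain ⟨⟨v, η⟩, rfl⟩ := hbij.2 X
    obtain rfl := (hv v η).1 hX
    exact ⟨mfderiv (𝓡 d) (𝓡 d) (fun x : G => g⁻¹ * x) g η, (ho _).trans (congrArg
      (fun w : EuclideanSpace ℝ (Fin d) => T (0, w)) (mfderiv_mul_mfderiv_inv_mul g η))⟩

/-- The connection form is the left translate of the vertical component. -/
theorem connForm_eq_of_frame {a : H.Total} {g : G}
    {T : (EuclideanSpace ℝ (Fin n) × EuclideanSpace ℝ (Fin d)) →L[ℝ]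
      (EuclideanSpace ℝ (Fin n) × EuclideanSpace ℝ (Fin d))}
    (hv : ∀ v η, T (v, η) ∈ H.vertical a ↔ v = 0)
    (hh : ∀ v η, T (v, η) ∈ H.horizontal a ↔ η = 0)
    (ho : ∀ ξ, H.orbitDeriv a ξ = T (0, mfderiv (𝓡 d) (𝓡 d) (fun h : G => g * h) 1 ξ))
    (v : EuclideanSpace ℝ (Fin n)) (η : EuclideanSpace ℝ (Fin d)) :
    H.connForm a (T (v, η)) = mfderiv (𝓡 d) (𝓡 d) (fun x : G => g⁻¹ * x) g η := by
  have hc := H.isCompl_vertical_horizontal a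
  have hproj : H.vertProj a (T (v, η)) = T (0, η) := by
    -- Complementarity is proved, so the default value 0 of the projection does not occur.
    refine (dif_pos hc).trans ?_
    have h1 : T (v, η) = T (0, η) + T (v, 0) := by
      rw [← map_add, Prod.mk_add_mk, add_zero, zero_add]
    have h2 : (H.vertical a).projectionOnto (H.horizontal a) hc (T (v, η)) =
        (H.vertical a).projectionOnto (H.horizontal a) hc (T (0, η)) +
        (H.vertical a).projectionOnto (H.horizontal a) hc (T (v, 0)) := by
      rw [h1]; exact map_add _ _ _
    rw [Submodule.projectionOnto_apply_of_mem_left hc ((hv 0 η).2 rfl),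
      Submodule.projectionOnto_apply_of_mem_right hc ((hh v 0).2 rfl), add_zero] at h2
    exact congrArg Subtype.val h2
  have horb : T (0, η) =
      H.orbitDeriv a (mfderiv (𝓡 d) (𝓡 d) (fun x : G => g⁻¹ * x) g η) := by
    exact ((ho _).trans (congrArg (fun w : EuclideanSpace ℝ (Fin d) => T (0, w))
      (mfderiv_mul_mfderiv_inv_mul g η))).symm
  exact (congrArg (Function.invFun (H.orbitDeriv a)) (hproj.trans horb)).trans
    (Function.leftInverse_invFun (H.injective_orbitDeriv a) _)

/-- The holonomy expression for the connection form along a curve of paths. -/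
theorem connForm_velocity (χ : ℝ → BasedPath n b) (γ : ℝ → G) {j : ℝ} {V : Set ℝ} (hV : IsOpen V)
    (hVc : Convex ℝ V) (hj : j ∈ V)
    (hχ : SmoothFamilyOn n 𝓘(ℝ, ℝ) V (fun i => (χ i : unitInterval → M)))
    (hγ : ContMDiffOn 𝓘(ℝ, ℝ) (𝓡 d) ∞ γ V) :
    let F : ℝ → G := fun i => H.val (pinv (χ i) ⊙ (arc (fun k => χ k 1) j i ⊙ χ j)) * γ i
    MDifferentiableAt 𝓘(ℝ, ℝ) ((𝓡 n).prod (𝓡 d)) (fun i => H.cls (χ i) (γ i)) j ∧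
    MDifferentiableAt 𝓘(ℝ, ℝ) (𝓡 d) F j ∧ F j = γ j ∧
    H.connForm (H.cls (χ j) (γ j)) (H.velocity (fun i => H.cls (χ i) (γ i)) j) =
      mfderiv (𝓡 d) (𝓡 d) (fun x : G => (γ j)⁻¹ * x) (γ j)
        (mfderiv 𝓘(ℝ, ℝ) (𝓡 d) F j (1 : ℝ)) := by
  intro F
  have hVj := hV.mem_nhds hj
  have hr : ContMDiffOn 𝓘(ℝ, ℝ) (𝓡 n) ∞ (fun i => χ i 1) V := hχ.contMDiffOn_one
  have harc := smoothFamilyOn_arc hVc hj hr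
  have hFs : ContMDiffOn 𝓘(ℝ, ℝ) (𝓡 d) ∞ F V := by
    refine ContMDiffOn.mul (H.contMDiffOn_val_space hV ?_ ?_ ?_) hγ
    · refine hχ.pinv.pcomp (harc.pcomp (SmoothFamilyOn.const (χ j).smooth V) ?_) ?_
      · intro i _; simp
      · intro i _; simp
    · intro i _; simp [(χ j).source]
    · intro i _; simp [(χ i).source]
  have hFd := (hFs.contMDiffAt hVj).mdifferentiableAt (by simp)
  have hFj : F j = γ j := by
    simp only [F]
    rw [H.val_pinv_arc_self (χ j) rfl, one_mul]
  -- Taking the frame at `χ j` itself makes `F` exactly the function that gives the second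
  -- component.
  obtain ⟨T, -, hv, hh, ho, hcore⟩ := H.exists_frame_splitting (χ j) (γ j)
  obtain ⟨R, hR⟩ : ∃ R : ℝ →L[ℝ] EuclideanSpace ℝ (Fin n),
      HasMFDerivAt 𝓘(ℝ, ℝ) (𝓡 n) (fun i => χ i 1) j R :=
    ⟨_, ((hr.contMDiffAt hVj).mdifferentiableAt (by simp)).hasMFDerivAt⟩
  obtain ⟨D, hD⟩ : ∃ D : ℝ →L[ℝ] EuclideanSpace ℝ (Fin d),
      HasMFDerivAt 𝓘(ℝ, ℝ) (𝓡 d) F j D := ⟨_, hFd.hasMFDerivAt⟩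
  have hc := hcore χ γ j V R D hVj hr rfl hR hD hFj
  refine ⟨hc.mdifferentiableAt, hFd, hFj, ?_⟩
  rw [velocity, hc.mfderiv, hD.mfderiv]
  exact H.connForm_eq_of_frame hv hh ho (R (1 : ℝ)) (D (1 : ℝ))

/-- Tangent spaces at propositionally equal points have different types but the same model space.
Stating `X` in the model allows a change of base point. -/
theorem connForm_congr {a a' : H.Total} (h : a = a')
    (X : EuclideanSpace ℝ (Fin n) × EuclideanSpace ℝ (Fin d)) :
    H.connForm a X = H.connForm a' X := by
  subst h; rfl

end HolonomyMap

end Connection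

/-! ### The tangent vectors of E, the holonomy formula and the local coefficients. -/

section Consequences

variable {n d : ℕ} {M : Type*} [TopologicalSpace M] [ChartedSpace (Euc n) M] [IsManifold (𝓡 n) ∞ M]
  {b : M} {G : Type*} [Group G] [TopologicalSpace G] [ChartedSpace (Euc d) G]

namespace HolonomyMap

variable [LieGroup (𝓡 d) ∞ G] [ConnectedSpace M] (H : HolonomyMap n d b G)

/-- In the frame `X = T (v, η)`. A based path with velocity `v` supplies the arcs that prolong `p`,
and a curve in G with velocity `η` supplies the group part; for such prolongations the arc
expression reduces to the curve in G. -/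
theorem exists_eq_velocity (a : H.Total) (X : TangentSpace ((𝓡 n).prod (𝓡 d)) a) :
    ∃ (χ : ℝ → BasedPath n b) (g : ℝ → G) (j : ℝ), SmoothNear d χ g j ∧ χ 0 1 = b ∧
      H.cls (χ j) (g j) = a ∧ X = H.velocity (fun i => H.cls (χ i) (g i)) j := by
  classical
  have : ContMDiffMul (𝓡 d) ∞ G := inferInstance
  have : IsManifold (𝓡 d) ∞ G := this.toIsManifold
  obtain ⟨⟨p, g⟩, rfl⟩ := H.exists_rep a
  obtain ⟨T, hbij, -, -, -, hcore⟩ := H.exists_frame_splitting p g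
  obtain ⟨⟨v, η⟩, rfl⟩ := hbij.2 X
  obtain ⟨r, j, δ, hδ, hsub, hr, hrj, hR⟩ := exists_basedPath_hasMFDerivAt (b := b) (p 1) v
  obtain ⟨γ, δ', hδ', hγ, hγj, hD⟩ := exists_curve_hasMFDerivAt g η j
  have harc := smoothFamilyOn_arc (convex_ball j δ) (Metric.mem_ball_self hδ) hr
  have h0 : ∀ i, p 1 = arc (IccExtend zero_le_one (r : unitInterval → M)) j i 0 := fun i => by
    rw [arc_zero, hrj]
  -- Away from `j` the contractions of `r` are used only so that the end point curve is `r`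
  -- throughout [0,1], hence piecewise smooth and starting at `b`.
  let χ : ℝ → BasedPath n b := fun i => if hi : i ∈ Metric.ball j δ then
    p.prolong _ (harc.piecewiseSmooth hi) (h0 i) else r.contr (projIcc 0 1 zero_le_one i)
  have hχ : ∀ i ∈ Metric.ball j δ, (χ i : unitInterval → M) =
      arc (IccExtend zero_le_one (r : unitInterval → M)) j i ⊙ p := fun i hi => by
    simp only [χ, dif_pos hi, BasedPath.prolong]
  have hχ1 : (fun i => χ i 1) = IccExtend zero_le_one (r : unitInterval → M) := by
    funext i
    by_cases hi : i ∈ Metric.ball j δ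
    · rw [hχ i hi]; simp
    · simp only [χ, dif_neg hi]
      simp [BasedPath.contr, LoopHolonomy.contr, IccExtend]
  have hχ1' : ∀ i, χ i 1 = IccExtend zero_le_one (r : unitInterval → M) i := congrFun hχ1
  have hj := Metric.mem_ball_self (x := j) hδ
  have hval : ∀ i ∈ Metric.ball j δ, H.val (pinv (χ i) ⊙
      (arc (fun k => χ k 1) j i ⊙ p)) * γ i = γ i := fun i hi => by
    have := H.val_self (χ i)
    rw [hχ i hi] at this
    rw [hχ1, hχ i hi, this, one_mul]
  have hcls : H.cls (χ j) (γ j) = H.cls p g := by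
    refine H.cls_eq_cls.2 ⟨by rw [hχ1', hrj], ?_⟩
    have h1 := H.val_pinv_arc_self p hrj
    have hpj : (χ j) 1 = p 1 := by rw [hχ1', hrj]
    have h2 := H.val_trans (p := p) (q := χ j) (r := p) hpj rfl
    rw [H.val_self, hχ j hj, h1, mul_one] at h2
    rw [hχ j hj, h2, one_mul, hγj]
  have hV : Metric.ball j (min δ δ') ⊆ Metric.ball j δ := Metric.ball_subset_ball (min_le_left _ _)
  refine ⟨χ, γ, j, ⟨hsub hj, ?_, Metric.ball j (min δ δ'), Metric.isOpen_ball,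
    Metric.mem_ball_self (lt_min hδ hδ'), ?_, ?_⟩, ?_, hcls, ?_⟩
  · have e : (fun i : unitInterval => χ i 1) = r := by
      funext i; rw [hχ1', IccExtend_val]
    rw [e]; exact r.smooth
  · exact ((harc.pcomp (SmoothFamilyOn.const p.smooth _) fun i _ => h0 i).congr hχ).mono hV
  · exact hγ.mono (Metric.ball_subset_ball (min_le_right _ _))
  · rw [hχ1']
    simp [r.source]
  · have hc := hcore χ γ j (Metric.ball j δ) _ _ (Metric.ball_mem_nhds j hδ) (by rw [hχ1]; exact hr)
      (by rw [hχ1', hrj]) (by rw [hχ1]; exact hR) (hD.congr_of_eventuallyEq (by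
        filter_upwards [Metric.ball_mem_nhds j hδ] with i hi
        exact hval i hi)) (by rw [hval j hj, hγj])
    rw [velocity, hc.mfderiv]
    change T (v, η) = T ((1 : ℝ) • v, (1 : ℝ) • η)
    rw [one_smul, one_smul]

/-- Near `j` the path K(p,i) ∘ K(p,j)⁻¹ can be exchanged for the direct arc of `p` at the cost of a
thin loop. The function differentiated here thus has the same germ as in `connForm_velocity`. -/
theorem connForm_velocity_contr (χ : ℝ → BasedPath n b) (g : ℝ → G) (j : ℝ)
    (h : SmoothNear d χ g j) :
    let p : unitInterval → M := fun i => χ i 1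
    let K : ℝ → unitInterval → M := fun i => contr p (projIcc 0 1 zero_le_one i)
    let F : ℝ → G := fun i => H.val (pinv (χ i) ⊙ (K i ⊙ pinv (K j)) ⊙ χ j) * g i
    MDifferentiableAt 𝓘(ℝ, ℝ) ((𝓡 n).prod (𝓡 d)) (fun i => H.cls (χ i) (g i)) j ∧
    MDifferentiableAt 𝓘(ℝ, ℝ) (𝓡 d) F j ∧ F j = g j ∧
    H.connForm (H.cls (χ j) (g j)) (H.velocity (fun i => H.cls (χ i) (g i)) j) =
      mfderiv (𝓡 d) (𝓡 d) (fun x : G => (g j)⁻¹ * x) (g j)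
        (mfderiv 𝓘(ℝ, ℝ) (𝓡 d) F j (1 : ℝ)) := by
  intro p K F
  obtain ⟨hj, hp, V, hV, hjV, hχ, hg⟩ := h
  obtain ⟨δ, hδ, hball⟩ := Metric.isOpen_iff.1 (hV.inter isOpen_Ioo) j ⟨hjV, hj⟩
  have hjb := Metric.mem_ball_self (x := j) hδ
  have hBV : Metric.ball j δ ⊆ V := fun t ht => (hball ht).1
  obtain ⟨h1, h2, h3, h4⟩ := H.connForm_velocity χ g Metric.isOpen_ball (convex_ball j δ) hjb
    (hχ.mono hBV) (hg.mono hBV)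
  let F' : ℝ → G := fun i => H.val (pinv (χ i) ⊙ (arc (fun k => χ k 1) j i ⊙ χ j)) * g i
  have hFF : ∀ i ∈ Metric.ball j δ, F i = F' i := by
    intro i hi
    have hproj : ∀ t ∈ Metric.ball j δ, ((projIcc 0 1 zero_le_one t : unitInterval) : ℝ) = t :=
      fun t ht => by rw [projIcc_of_mem _ (Ioo_subset_Icc_self (hball ht).2)]
    have hpt : ∀ t ∈ Metric.ball j δ, p (projIcc 0 1 zero_le_one t) = χ t 1 := fun t ht => by
      simp only [p, hproj t ht]
    have hK1 : ∀ t ∈ Metric.ball j δ, K t 1 = χ t 1 := fun t ht => by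
      rw [← hpt t ht]; simp [K, LoopHolonomy.contr]
    have hK0 : K j 0 = K i 0 := by simp [K, LoopHolonomy.contr]
    -- Outside [0,1] the end points of `χ` and the extension of `p` may differ, but the arc only
    -- uses parameters of the ball.
    have ha : arc (fun k => χ k 1) j i = arc (IccExtend zero_le_one p) j i := by
      funext t
      have ht := convex_ball j δ hjb hi (sub_nonneg.2 t.2.2) t.2.1 (by ring)
      have e : (1 - (t : ℝ)) • j + (t : ℝ) • i = j + t * (i - j) := by
        simp only [smul_eq_mul]; ring
      rw [e] at ht
      simp only [arc]
      rw [← hpt _ ht]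
      rfl
    have harc := (smoothFamilyOn_arc (convex_ball j δ) hjb
      (hχ.contMDiffOn_one.mono hBV)).piecewiseSmooth hi
    have hKs : PiecewiseSmooth n (K i ⊙ pinv (K j)) :=
      (hp.contr _).pcomp (hp.contr _).pinv ((pinv_one _).trans hK0)
    have hthin := isThin_arc_contr hp.1 (projIcc 0 1 zero_le_one i) (projIcc 0 1 zero_le_one j)
      (χ j).smooth.1 (hpt j hjb).symm
    rw [hproj i hi, hproj j hjb, ← ha] at hthin
    have key := H.val_congr_right (χ i) (q := (χ j).prolong _ harc (by simp))
      (r := (χ j).prolong _ hKs (by simp [hK1 j hjb])) (by simp [BasedPath.prolong])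
      (by simp [BasedPath.prolong, hK1 i hi]) hthin
    exact congrArg (· * g i) key
  have hev : F =ᶠ[𝓝 j] F' := by
    filter_upwards [Metric.ball_mem_nhds j hδ] with i hi
    exact hFF i hi
  refine ⟨h1, h2.congr_of_eventuallyEq hev, (hFF j hjb).trans h3, h4.trans ?_⟩
  have hd : HasMFDerivAt 𝓘(ℝ, ℝ) (𝓡 d) F j (mfderiv 𝓘(ℝ, ℝ) (𝓡 d) F' j) :=
    HasMFDerivAt.congr_of_eventuallyEq h2.hasMFDerivAt hev
  rw [hd.mfderiv]
  rfl

/-- Restricted to a coordinate line through `x`, the section is a curve {ψ[·],e} whose end points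
trace a straight line in the coordinates, so `connForm_velocity` applies. Convexity of the target
puts the segments in the domain and makes them a smooth family. -/
theorem localCoeff_eq (ψ : LocalFamily n b) (φ : OpenPartialHomeomorph M (Euc n))
    (hφ : φ ∈ IsManifold.maximalAtlas (𝓡 n) ∞ M) (hsub : φ.source ⊆ ψ.U)
    (hconv : Convex ℝ φ.target) (x : M) (hx : x ∈ φ.source) :
    let F : Euc n → G := fun y =>
      H.val (pinv (ψ (φ.symm y)) ⊙ straightPath φ y (φ x) ⊙ ψ x)
    MDifferentiableAt (𝓡 n) ((𝓡 n).prod (𝓡 d)) (H.localSection ψ) x ∧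
    MDifferentiableAt (𝓡 n) (𝓡 d) F (φ x) ∧ F (φ x) = 1 ∧
    ∀ μ : Fin n, H.localCoeff ψ φ μ x =
      mfderiv (𝓡 n) (𝓡 d) F (φ x) (EuclideanSpace.single μ (1 : ℝ)) := by
  intro F
  have hφs : ContMDiffOn (𝓡 n) (𝓡 n) ∞ φ.symm φ.target := contMDiffOn_symm_of_mem_maximalAtlas hφ
  have hxt : φ x ∈ φ.target := φ.map_source hx
  have hxx : φ.symm (φ x) = x := φ.left_inv hx
  have hmaps : ∀ y ∈ φ.target, φ.symm y ∈ ψ.U := fun y hy => hsub (φ.map_target hy)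
  have hσ : MDifferentiableAt (𝓡 n) ((𝓡 n).prod (𝓡 d)) (H.localSection ψ) x := by
    have h1 := (H.contMDiffOn_cls_localFamily ψ).comp (f := fun u : M => (u, (1 : G)))
      (contMDiff_id.prodMk contMDiff_const).contMDiffOn (s := ψ.U) fun u hu => ⟨hu, trivial⟩
    exact (h1.contMDiffAt (ψ.isOpen.mem_nhds (hsub hx))).mdifferentiableAt (by simp)
  have hstr : SmoothFamilyOn n (𝓡 n) φ.target (fun y => straightPath φ y (φ x)) := by
    refine smoothFamilyOn_of_contMDiffOn
      (f := fun z : Euc n × ℝ => φ.symm (φ x + z.2 • (z.1 - φ x))) ?_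
    refine hφs.comp (contMDiff_of_contDiff_prod (by fun_prop : ContDiff ℝ ∞
      fun z : Euc n × ℝ => φ x + z.2 • (z.1 - φ x))).contMDiffOn fun z hz => ?_
    have := hconv hxt hz.1 (sub_nonneg.2 hz.2.2) hz.2.1 (by ring)
    have e : (1 - z.2) • φ x + z.2 • z.1 = φ x + z.2 • (z.1 - φ x) := by module
    rwa [e] at this
  have hs0 : ∀ y, straightPath φ y (φ x) 0 = x := fun y => by simp [straightPath, hxx]
  have hs1 : ∀ y, straightPath φ y (φ x) 1 = φ.symm y := fun y => by simp [straightPath]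
  have hFs : ContMDiffOn (𝓡 n) (𝓡 d) ∞ F φ.target := by
    refine H.contMDiffOn_val_space φ.open_target ((ψ.smooth.comp hφs hmaps).pinv.pcomp
      (hstr.pcomp (SmoothFamilyOn.const (ψ x).smooth _) ?_) ?_) ?_ ?_
    · intro y _; rw [hs0, ψ.tip _ (hsub hx)]
    · intro y hy; simp [hs1, ψ.tip _ (hmaps y hy)]
    · intro y _; simp [(ψ x).source]
    · intro y _; simp [(ψ (φ.symm y)).source]
  have hFd : MDifferentiableAt (𝓡 n) (𝓡 d) F (φ x) :=
    (hFs.contMDiffAt (φ.open_target.mem_nhds hxt)).mdifferentiableAt (by simp)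
  refine ⟨hσ, hFd, ?_, fun μ => ?_⟩
  · have e : straightPath φ (φ x) (φ x) = fun _ => (ψ x) 1 := by
      funext t; simp [straightPath, hxx, ψ.tip _ (hsub hx)]
    simp only [F, e, hxx]
    exact H.val_thin (isThin_const_pcomp (ψ x).smooth.1)
  set e : EuclideanSpace ℝ (Fin n) := EuclideanSpace.single μ (1 : ℝ) with he
  let ℓ : ℝ → Euc n := fun t => φ x + t • e
  have hℓ : ContDiff ℝ ∞ ℓ := by fun_prop
  have hℓ0 : ℓ 0 = φ x := by simp [ℓ]
  have hℓd : HasMFDerivAt 𝓘(ℝ, ℝ) (𝓡 n) ℓ 0 ((1 : ℝ →L[ℝ] ℝ).smulRight e) := by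
    have := ((hasDerivAt_id (0 : ℝ)).smul_const e).const_add (φ x)
    rw [one_smul] at this
    exact this.hasFDerivAt.hasMFDerivAt
  let V : Set ℝ := ℓ ⁻¹' φ.target
  have hVo : IsOpen V := φ.open_target.preimage hℓ.continuous
  have hVc : Convex ℝ V := by
    intro s hs t ht α β hα hβ hαβ
    have h1 := hconv hs ht hα hβ hαβ
    have h2 : α • ℓ s + β • ℓ t = ℓ (α • s + β • t) := by
      obtain rfl : α = 1 - β := by linarith
      simp only [ℓ, smul_eq_mul]
      module
    rwa [h2] at h1
  have hV0 : (0 : ℝ) ∈ V := by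
    change ℓ 0 ∈ φ.target
    rw [hℓ0]; exact hxt
  have hcurve : ContMDiffOn 𝓘(ℝ, ℝ) (𝓡 n) ∞ (fun t => φ.symm (ℓ t)) V :=
    hφs.comp hℓ.contMDiff.contMDiffOn fun t ht => ht
  obtain ⟨-, -, -, hω⟩ := H.connForm_velocity (fun t => ψ (φ.symm (ℓ t))) (fun _ => 1) hVo hVc hV0
    (ψ.smooth.comp hcurve fun t ht => hmaps _ ht) contMDiffOn_const
  have hc0 : φ.symm (ℓ 0) = x := by rw [hℓ0, hxx]
  -- The arc along the coordinate line is the straight segment itself, so the holonomy function of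
  -- the curve is `F` restricted to the line.
  have hFF : (fun i => H.val (pinv (ψ (φ.symm (ℓ i))) ⊙
      (arc (fun k => ψ (φ.symm (ℓ k)) 1) 0 i ⊙ ψ (φ.symm (ℓ 0)))) * 1) =ᶠ[𝓝 0] F ∘ ℓ := by
    filter_upwards [hVo.mem_nhds hV0] with i hi
    have ha : arc (fun k => ψ (φ.symm (ℓ k)) 1) 0 i = straightPath φ (ℓ i) (φ x) := by
      funext t
      have ht := hVc hV0 hi (sub_nonneg.2 t.2.2) t.2.1 (by ring)
      have e1 : (1 - (t : ℝ)) • (0 : ℝ) + (t : ℝ) • i = 0 + t * (i - 0) := by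
        simp
      rw [e1] at ht
      simp only [arc, straightPath]
      rw [ψ.tip _ (hmaps _ ht)]
      simp [ℓ, mul_smul]
    rw [ha, hc0, mul_one]
    rfl
  have hφd : HasMFDerivAt (𝓡 n) (𝓡 n) φ.symm (ℓ 0) (mfderiv (𝓡 n) (𝓡 n) φ.symm (φ x)) := by
    rw [hℓ0]
    exact ((hφs.contMDiffAt (φ.open_target.mem_nhds hxt)).mdifferentiableAt (by simp)).hasMFDerivAt
  have hFd' : HasMFDerivAt (𝓡 n) (𝓡 d) F (ℓ 0) (mfderiv (𝓡 n) (𝓡 d) F (φ x)) := by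
    rw [hℓ0]; exact hFd.hasMFDerivAt
  have hσ' : HasMFDerivAt (𝓡 n) ((𝓡 n).prod (𝓡 d)) (H.localSection ψ) (φ.symm (ℓ 0))
      (mfderiv (𝓡 n) ((𝓡 n).prod (𝓡 d)) (H.localSection ψ) x) := by
    rw [hc0]; exact hσ.hasMFDerivAt
  have hvel := (HasMFDerivAt.comp (f := fun t => φ.symm (ℓ t)) (0 : ℝ) hσ'
    (HasMFDerivAt.comp (f := ℓ) (0 : ℝ) hφd hℓd)).mfderiv
  have hFℓ := ((HasMFDerivAt.comp (f := ℓ) (0 : ℝ) hFd' hℓd).congr_of_eventuallyEq hFF).mfderiv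
  -- The group part of the section is constantly `1`, so the left translation in the formula is
  -- trivial.
  have hone : ∀ w : EuclideanSpace ℝ (Fin d),
      mfderiv (𝓡 d) (𝓡 d) (fun y : G => (1 : G)⁻¹ * y) 1 w = w := fun w => by
    have : (fun y : G => (1 : G)⁻¹ * y) = id := by funext y; simp
    rw [this, mfderiv_id]
    rfl
  have h1 : H.localCoeff ψ φ μ x = H.connForm (H.localSection ψ x)
      (H.velocity (fun t => H.cls (ψ (φ.symm (ℓ t))) 1) 0) := by
    refine congrArg (H.connForm (H.localSection ψ x)) ?_
    refine Eq.trans ?_ (DFunLike.congr_fun hvel (1 : ℝ)).symm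
    change _ = mfderiv (𝓡 n) ((𝓡 n).prod (𝓡 d)) (H.localSection ψ) x
      (mfderiv (𝓡 n) (𝓡 n) φ.symm (φ x) ((1 : ℝ) • e))
    rw [one_smul]
  refine h1.trans ((H.connForm_congr (by rw [hc0]; rfl) _).trans (hω.trans ((hone _).trans ?_)))
  refine (DFunLike.congr_fun hFℓ (1 : ℝ)).trans ?_
  change mfderiv (𝓡 n) (𝓡 d) F (φ x) ((1 : ℝ) • e) = _
  rw [one_smul]

end HolonomyMap

end Consequences

end LoopHolonomy

theorem mainTheorem2 {n d : ℕ}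
    {M : Type*} [TopologicalSpace M] [T2Space M] [ConnectedSpace M]
    [ChartedSpace (Euc n) M] [IsManifold (𝓡 n) ∞ M]
    {G : Type*} [Group G] [TopologicalSpace G] [ChartedSpace (Euc d) G] [LieGroup (𝓡 d) ∞ G]
    (b : M) (H : HolonomyMap n d b G) :
    -- The vertical projection and the inverse of the differential of `g ↦ ag` make sense.
    (∀ a : H.Total, IsCompl (H.vertical a) (H.horizontal a) ∧
      Function.Injective (H.orbitDeriv a) ∧ range (H.orbitDeriv a) = H.vertical a) ∧
    -- Every tangent vector of `E` has the form `d/di {χ[i],g(i)}` at `i = j`.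
    (∀ (a : H.Total) (X : TangentSpace ((𝓡 n).prod (𝓡 d)) a),
      ∃ (χ : ℝ → BasedPath n b) (g : ℝ → G) (j : ℝ), SmoothNear d χ g j ∧ χ 0 1 = b ∧
        H.cls (χ j) (g j) = a ∧ X = H.velocity (fun i => H.cls (χ i) (g i)) j) ∧
    -- The holonomy expression for the connection 1-form.
    (∀ (χ : ℝ → BasedPath n b) (g : ℝ → G) (j : ℝ), SmoothNear d χ g j →
      let p : unitInterval → M := fun i => χ i 1
      let K : ℝ → unitInterval → M := fun i => contr p (projIcc 0 1 zero_le_one i)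
      let F : ℝ → G := fun i => H.val (pinv (χ i) ⊙ (K i ⊙ pinv (K j)) ⊙ χ j) * g i
      MDifferentiableAt 𝓘(ℝ, ℝ) ((𝓡 n).prod (𝓡 d)) (fun i => H.cls (χ i) (g i)) j ∧
      MDifferentiableAt 𝓘(ℝ, ℝ) (𝓡 d) F j ∧ F j = g j ∧
      H.connForm (H.cls (χ j) (g j)) (H.velocity (fun i => H.cls (χ i) (g i)) j) =
        mfderiv (𝓡 d) (𝓡 d) (fun x : G => (g j)⁻¹ * x) (g j)
          (mfderiv 𝓘(ℝ, ℝ) (𝓡 d) F j (1 : ℝ))) ∧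
    -- The local coefficients.
    (∀ (ψ : LocalFamily n b) (φ : OpenPartialHomeomorph M (Euc n)),
      φ ∈ IsManifold.maximalAtlas (𝓡 n) ∞ M → φ.source ⊆ ψ.U → Convex ℝ φ.target →
      ∀ x ∈ φ.source,
        let F : Euc n → G := fun y =>
          H.val (pinv (ψ (φ.symm y)) ⊙ straightPath φ y (φ x) ⊙ ψ x)
        MDifferentiableAt (𝓡 n) ((𝓡 n).prod (𝓡 d)) (H.localSection ψ) x ∧
        MDifferentiableAt (𝓡 n) (𝓡 d) F (φ x) ∧ F (φ x) = 1 ∧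
        ∀ μ : Fin n, H.localCoeff ψ φ μ x =
          mfderiv (𝓡 n) (𝓡 d) F (φ x) (EuclideanSpace.single μ (1 : ℝ))) := by
  exact ⟨fun a => ⟨H.isCompl_vertical_horizontal a, H.injective_orbitDeriv a, H.range_orbitDeriv a⟩,
    H.exists_eq_velocity, H.connForm_velocity_contr, H.localCoeff_eq⟩
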